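/- Let $\Lambda$ be an Artin algebra, i.e. an algebra over a commutative artinian ring $R$ that is finitely generated as an $R$-module. Let $\mathrm{Mod}\text{-}\Lambda$ (resp. $\mathrm{mod}\text{-}\Lambda$) be the category of all (resp. finitely generated) left $\Lambda$-modules, and let $n\ge 1$ be an integer. A full subcategory $\mathcal M$ of an abelian category $\mathcal A$ is called an $n$-cluster tilting subcategory if - every object of $\mathcal A$ is a quotient of an object of $\mathcal M$ and a subobject of an object of $\mathcal M$; - $\mathcal M$ is functorially finite: for every $A\in\mathcal A$ there are objects $M,M'\in\mathcal M$ and morphisms $M\to A$ and $A\to M'$ such that every morphism $N\to A$ with $N\in\mathcal M$ factors through $M\to A$ and every morphism $A\to N$ with $N\in\mathcal M$ factors through $A\to M'$; - $\mathcal M=\{X\in\mathcal A \mid \mathrm{Ext}^i_{\mathcal A}(X,M)=0 \text{ for all } M\in\mathcal M,\ 1\le i\le n-1\}=\{X\in\mathcal A \mid \mathrm{Ext}^i_{\mathcal A}(M,X)=0\text{ for all } M\in\mathcal M,\ 1\le i\le n-1\}$. Let $\mathfrak m$ be an $n$-cluster tilting subcategory of $\mathrm{mod}\text{-}\Lambda$.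 Then the following are equivalent. (i) $\mathrm{Add}(\mathfrak m)$, the full subcategory of $\mathrm{Mod}\text{-}\Lambda$ consisting of all direct summands of arbitrary direct sums of modules in $\mathfrak m$, is an $n$-cluster tilting subcategory of $\mathrm{Mod}\text{-}\Lambda$. (ii) $\mathfrak m$ has an additive generator: there is a module $M\in\mathfrak m$ such that $\mathfrak m=\mathrm{add}(M)$, i.e. $\mathfrak m$ consists precisely of the direct summands of finite direct sums of copies of $M$. -/

import Mathlib

universe w v u

open CategoryTheory Limits Abelian

namespace CategoryTheory.ObjectProperty

section Add

variable {C : Type u} [Category.{v} C]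

/-- `Add(P)`: the objects that are direct summands of (arbitrary, possibly infinite) direct sums
of objects satisfying `P`. The index sets range over `Type w`. A direct summand
is expressed as a retract, which is the same thing in an abelian category. -/
def addClosure [HasCoproducts.{w} C] (P : ObjectProperty C) : ObjectProperty C := fun X =>
  ∃ (ι : Type w) (F : ι → C), (∀ i, P (F i)) ∧ Nonempty (Retract X (∐ F))

/-- `add(P)`: the objects that are direct summands of finite direct sums of objects
satisfying `P`. -/
def finiteAddClosure [HasZeroMorphisms C] [HasFiniteBiproducts C] (P : ObjectProperty C) :
    ObjectProperty C := fun X =>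
  ∃ (k : ℕ) (F : Fin k → C), (∀ i, P (F i)) ∧ Nonempty (Retract X (⨁ F))

/-- `P` has an additive generator: `P = add(M)` for a single object `M`. -/
def HasAdditiveGenerator [HasZeroMorphisms C] [HasFiniteBiproducts C]
    (P : ObjectProperty C) : Prop :=
  ∃ M : C, P = finiteAddClosure (ObjectProperty.singleton M)

/-- Every object has a right `P`-approximation. -/
def IsContravariantlyFinite (P : ObjectProperty C) : Prop :=
  ∀ A : C, ∃ (M : C) (f : M ⟶ A), P M ∧ ∀ (N : C), P N → ∀ g : N ⟶ A, ∃ h : N ⟶ M, h ≫ f = g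

/-- Every object has a left `P`-approximation. -/
def IsCovariantlyFinite (P : ObjectProperty C) : Prop :=
  ∀ A : C, ∃ (M : C) (f : A ⟶ M), P M ∧ ∀ (N : C), P N → ∀ g : A ⟶ N, ∃ h : M ⟶ N, f ≫ h = g

/-- Every object is a quotient of an object satisfying `P`. -/
def IsGenerating (P : ObjectProperty C) : Prop :=
  ∀ X : C, ∃ (Y : C) (f : Y ⟶ X), P Y ∧ Epi f

/-- Every object is a subobject of an object satisfying `P`. -/
def IsCogenerating (P : ObjectProperty C) : Prop :=
  ∀ X : C, ∃ (Y : C) (f : X ⟶ Y), P Y ∧ Mono f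

end Add

/-- The full subcategory of the abelian category `C` on the objects satisfying `P` is an
`n`-cluster tilting subcategory of `C`. -/
structure IsClusterTilting {C : Type u} [Category.{v} C] [Abelian C] [HasExt.{w} C]
    (n : ℕ) (P : ObjectProperty C) : Prop where
  generating : P.IsGenerating
  cogenerating : P.IsCogenerating
  contravariantlyFinite : P.IsContravariantlyFinite
  covariantlyFinite : P.IsCovariantlyFinite
  iff_ext_left (X : C) :
    P X ↔ ∀ i : ℕ, 1 ≤ i → i < n → ∀ M : C, P M → Subsingleton (Ext.{w} X M i)
  iff_ext_right (X : C) :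
    P X ↔ ∀ i : ℕ, 1 ≤ i → i < n → ∀ M : C, P M → Subsingleton (Ext.{w} M X i)

end CategoryTheory.ObjectProperty

/-- Morphisms in the derived category of `C` always form types in the larger of the two universes
of `C`; this makes the groups `Ext` in `mod-Λ` available. -/
instance FGModuleCat.hasExt (A : Type u) [Ring A] [IsNoetherianRing A] :
    HasExt.{u + 1} (FGModuleCat.{u} A) :=
  HasExt.standard _

/-- `mod-Λ` has finite direct sums. -/
instance FGModuleCat.hasFiniteBiproducts (A : Type u) [Ring A] [IsNoetherianRing A] :
    HasFiniteBiproducts (FGModuleCat.{u} A) :=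
  Abelian.hasFiniteBiproducts

/-- An Artin algebra is a noetherian ring, so that its finitely generated modules form an
abelian category. -/
theorem isNoetherianRing_of_artinAlgebra (R : Type v) (A : Type u) [CommRing R]
    [IsArtinianRing R] [Ring A] [Algebra R A] [Module.Finite R A] : IsNoetherianRing A :=
  isNoetherian_of_tower R inferInstance

/-!
Let `P` be the class of modules isomorphic to one in `m`. A module `X` is called *locally* in `P` if
every map from a finitely generated module to `X` factors through a module in `P`. The first
observation, for which left `m`-approximations are used, is that `X` is locally in `P` if and only if
`Ext^i(P, X) = 0` for `1 ≤ i < n` (`ModuleCat.IsFGClusterTilting.isLocally_iff_ext`). Since `Ext` turns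
direct sums in its first argument into products, the cluster tilting property of `Add P` forces every
module locally in `P` to lie in `Add P`. Products of modules in `P`, and quotients of modules locally
in `P` by pure submodules, are locally in `P`.

*From an additive generator `M` to the cluster tilting property.* Let `X` be locally in `add M`.
The radical of `End M` is nilpotent, so a nonzero `X` receives from some indecomposable summand of `M`
a map which is a split monomorphism into every finitely generated module through which it factors
(`Module.IsLocallyAdd.exists_isLocallySplit`). Its image is a pure submodule. By Zorn's lemma a
maximal independent family of summands of `M` in `X` with pure sum has sum `X`
(`Module.IsLocallyAdd.exists_isInternal`), so `X` is in `Add P`. Thus `Add P` contains the products of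
modules in `P`, in which the direct sums are therefore summands, so that `Add P` is exactly
the class of modules locally in `P`. Rigidity, half of the maximality, and the approximations follow;
the other half of the maximality is formal
(`CategoryTheory.ObjectProperty.of_ext_left_of_generating`).

*From the cluster tilting property to an additive generator.* Suppose that `P` contained infinitely
many pairwise nonisomorphic indecomposables `N i`. The families of finite support form a pure
submodule of `∏ N i`. The quotient is locally in `P`, hence in `Add P`, hence a summand of the product,
and it has an indecomposable finitely generated summand `L`. Every split monomorphism `L → ∏ N i` has
a component that is an isomorphism: by Matlis duality the endomorphisms of `L` factoring through the
components generate the unit left ideal (`Ideal.span_endomorphisms_eq_top_of_split_pi`), and `End L`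
is local. As the retraction vanishes on families of finite support, any single component may be
replaced by zero, so `L` is isomorphic to two different `N i`, a contradiction
(`ModuleCat.IsFGClusterTilting.exists_finset_indecomposable`). The product of the finitely many
indecomposables is the additive generator.

The passage between `mod-Λ` and `Mod-Λ` rests on the equality of the groups `Ext` computed in the two
categories (`FGModuleCat.subsingleton_ext_iff`).
-/

/-! ### Vanishing of `Ext` and dimension shifting -/

namespace CategoryTheory.Abelian.Ext

section Shifting

variable {C : Type u} [Category.{v} C] [Abelian C] [HasExt.{w} C] {S : ShortComplex C}

theorem subsingleton_X₃_left (hS : S.ShortExact) (Y : C) (i : ℕ)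
    (h₁ : Subsingleton (Ext.{w} S.X₁ Y i)) (h₂ : Subsingleton (Ext.{w} S.X₂ Y (i + 1))) :
    Subsingleton (Ext.{w} S.X₃ Y (i + 1)) := by
  refine subsingleton_of_forall_eq 0 fun x ↦ ?_
  obtain ⟨y, rfl⟩ := contravariant_sequence_exact₃ hS Y x (Subsingleton.elim _ _) (add_comm 1 i)
  rw [Subsingleton.elim y 0, comp_zero]

theorem subsingleton_X₁_left (hS : S.ShortExact) (Y : C) (i : ℕ)
    (h₂ : Subsingleton (Ext.{w} S.X₂ Y i)) (h₃ : Subsingleton (Ext.{w} S.X₃ Y (i + 1))) :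
    Subsingleton (Ext.{w} S.X₁ Y i) := by
  refine subsingleton_of_forall_eq 0 fun x ↦ ?_
  obtain ⟨y, rfl⟩ := contravariant_sequence_exact₁ hS Y x (add_comm 1 i) (Subsingleton.elim _ _)
  rw [Subsingleton.elim y 0, comp_zero]

theorem subsingleton_X₁_right (hS : S.ShortExact) (X : C) (i : ℕ)
    (h₃ : Subsingleton (Ext.{w} X S.X₃ i)) (h₂ : Subsingleton (Ext.{w} X S.X₂ (i + 1))) :
    Subsingleton (Ext.{w} X S.X₁ (i + 1)) := by
  refine subsingleton_of_forall_eq 0 fun x ↦ ?_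
  obtain ⟨y, rfl⟩ := covariant_sequence_exact₁ X hS x (Subsingleton.elim _ _) rfl
  rw [Subsingleton.elim y 0, zero_comp]

theorem subsingleton_X₃_right (hS : S.ShortExact) (X : C) (i : ℕ)
    (h₂ : Subsingleton (Ext.{w} X S.X₂ i)) (h₁ : Subsingleton (Ext.{w} X S.X₁ (i + 1))) :
    Subsingleton (Ext.{w} X S.X₃ i) := by
  refine subsingleton_of_forall_eq 0 fun x ↦ ?_
  obtain ⟨y, rfl⟩ := covariant_sequence_exact₃ X hS x rfl (Subsingleton.elim _ _)
  rw [Subsingleton.elim y 0, zero_comp]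

theorem exists_extension (hS : S.ShortExact) {Y : C} (h₃ : Subsingleton (Ext.{w} S.X₃ Y 1))
    (f : S.X₁ ⟶ Y) : ∃ g : S.X₂ ⟶ Y, S.f ≫ g = f := by
  obtain ⟨y, hy⟩ := contravariant_sequence_exact₁ hS Y (mk₀ f) rfl (Subsingleton.elim _ _)
  obtain ⟨g, rfl⟩ := mk₀_bijective _ _ |>.2 y
  rw [mk₀_comp_mk₀] at hy
  exact ⟨g, (mk₀_bijective _ _).1 hy⟩

theorem exists_lift (hS : S.ShortExact) {X : C} (h₁ : Subsingleton (Ext.{w} X S.X₁ 1))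
    (f : X ⟶ S.X₃) : ∃ g : X ⟶ S.X₂, g ≫ S.g = f := by
  obtain ⟨y, hy⟩ := covariant_sequence_exact₃ X hS (mk₀ f) (zero_add 1) (Subsingleton.elim _ _)
  obtain ⟨g, rfl⟩ := mk₀_bijective _ _ |>.2 y
  rw [mk₀_comp_mk₀] at hy
  exact ⟨g, (mk₀_bijective _ _).1 hy⟩

theorem subsingleton_X₃_one_left (hS : S.ShortExact) (Y : C)
    (h₂ : Subsingleton (Ext.{w} S.X₂ Y 1)) (h : ∀ f : S.X₁ ⟶ Y, ∃ g : S.X₂ ⟶ Y, S.f ≫ g = f) :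
    Subsingleton (Ext.{w} S.X₃ Y 1) := by
  refine subsingleton_of_forall_eq 0 fun x ↦ ?_
  obtain ⟨y, rfl⟩ := contravariant_sequence_exact₃ hS Y x (Subsingleton.elim _ _) (add_zero 1)
  obtain ⟨f, rfl⟩ := mk₀_bijective _ _ |>.2 y
  obtain ⟨g, rfl⟩ := h f
  rw [← mk₀_comp_mk₀, ShortComplex.ShortExact.extClass_comp_assoc]

theorem subsingleton_X₁_one_right (hS : S.ShortExact) (X : C)
    (h₂ : Subsingleton (Ext.{w} X S.X₂ 1)) (h : ∀ f : X ⟶ S.X₃, ∃ g : X ⟶ S.X₂, g ≫ S.g = f) :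
    Subsingleton (Ext.{w} X S.X₁ 1) := by
  refine subsingleton_of_forall_eq 0 fun x ↦ ?_
  obtain ⟨y, rfl⟩ := covariant_sequence_exact₁ X hS x (Subsingleton.elim _ _) (zero_add 1)
  obtain ⟨f, rfl⟩ := mk₀_bijective _ _ |>.2 y
  obtain ⟨g, rfl⟩ := h f
  rw [← mk₀_comp_mk₀, comp_assoc_of_second_deg_zero, ShortComplex.ShortExact.comp_extClass,
    comp_zero]

theorem subsingleton_of_retract_left {X X' : C} (r : Retract X X') {Y : C} {i : ℕ}
    (h : Subsingleton (Ext.{w} X' Y i)) : Subsingleton (Ext.{w} X Y i) := by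
  refine subsingleton_of_forall_eq 0 fun x ↦ ?_
  rw [← mk₀_id_comp x, ← r.retract, ← mk₀_comp_mk₀_assoc,
    Subsingleton.elim ((mk₀ r.r).comp x (zero_add i)) 0, comp_zero]

theorem subsingleton_of_retract_right {Y Y' : C} (r : Retract Y Y') {X : C} {i : ℕ}
    (h : Subsingleton (Ext.{w} X Y' i)) : Subsingleton (Ext.{w} X Y i) := by
  refine subsingleton_of_forall_eq 0 fun x ↦ ?_
  rw [← comp_mk₀_id x, ← r.retract, ← mk₀_comp_mk₀, ← comp_assoc_of_second_deg_zero,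
    Subsingleton.elim (x.comp (mk₀ r.i) (add_zero i)) 0, zero_comp]

/-- `Ext` out of a coproduct vanishes as soon as it vanishes on each summand: shift dimensions
along an embedding of the second argument into an injective object. -/
theorem subsingleton_sigma [EnoughInjectives C] {ι : Type*} (X : ι → C) [HasCoproduct X] (i : ℕ)
    (Y : C) (h : ∀ j, Subsingleton (Ext.{w} (X j) Y (i + 1))) :
    Subsingleton (Ext.{w} (∐ X) Y (i + 1)) := by
  induction i generalizing Y with
  | zero =>
    let S := ShortComplex.mk _ _ (cokernel.condition (Injective.ι Y))
    have hS : S.ShortExact := { exact := ShortComplex.exact_cokernel (Injective.ι Y) }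
    refine subsingleton_X₁_one_right hS _ (subsingleton_of_injective _ (Injective.under Y) 0)
      fun f ↦ ?_
    choose g hg using fun j ↦ exists_lift hS (h j) (Sigma.ι X j ≫ f)
    exact ⟨Limits.Sigma.desc g, by ext j; simp [hg]⟩
  | succ i ih =>
    let S := ShortComplex.mk _ _ (cokernel.condition (Injective.ι Y))
    have hS : S.ShortExact := { exact := ShortComplex.exact_cokernel (Injective.ι Y) }
    exact subsingleton_X₁_right hS _ _
      (ih _ fun j ↦ subsingleton_X₃_right hS _ _
        (subsingleton_of_injective _ (Injective.under Y) i) (h j))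
      (subsingleton_of_injective _ (Injective.under Y) _)

/-- `Ext` into a product vanishes as soon as it vanishes on each factor. -/
theorem subsingleton_pi [EnoughProjectives C] {ι : Type*} (Y : ι → C) [HasProduct Y] (i : ℕ)
    (X : C) (h : ∀ j, Subsingleton (Ext.{w} X (Y j) (i + 1))) :
    Subsingleton (Ext.{w} X (∏ᶜ Y) (i + 1)) := by
  induction i generalizing X with
  | zero =>
    let S := ShortComplex.mk _ _ (kernel.condition (Projective.π X))
    have hS : S.ShortExact := { exact := ShortComplex.exact_kernel (Projective.π X) }
    refine subsingleton_X₃_one_left hS _ (subsingleton_of_projective (Projective.over X) _ 0)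
      fun f ↦ ?_
    choose g hg using fun j ↦ exists_extension hS (h j) (f ≫ Pi.π Y j)
    exact ⟨Pi.lift g, by ext j; simp [hg]⟩
  | succ i ih =>
    let S := ShortComplex.mk _ _ (kernel.condition (Projective.π X))
    have hS : S.ShortExact := { exact := ShortComplex.exact_kernel (Projective.π X) }
    exact subsingleton_X₃_left hS _ _
      (ih _ fun j ↦ subsingleton_X₁_left hS _ _
        (subsingleton_of_projective (Projective.over X) _ i) (h j))
      (subsingleton_of_projective (Projective.over X) _ _)

end Shifting

end CategoryTheory.Abelian.Ext

namespace CategoryTheory.ObjectProperty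

variable {C : Type u} [Category.{v} C] [Abelian C] [HasExt.{w} C] {n : ℕ} {P : ObjectProperty C}

/-- If `Ext^i(P, K) = 0` for `1 ≤ i ≤ j`, and `Ext^i(X, P) = 0` for `1 ≤ i < n`, then
`Ext^j(X, K) = 0`. The proof is a descending induction on `j`, passing from `K` to the kernel of a
right `P`-approximation, which has one more degree of vanishing. -/
theorem ext_subsingleton_of_generating (gen : P.IsGenerating) (fin : P.IsContravariantlyFinite)
    (rigid : ∀ i : ℕ, 1 ≤ i → i < n → ∀ M N : C, P M → P N → Subsingleton (Ext.{w} M N i))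
    (right : ∀ X : C, (∀ i : ℕ, 1 ≤ i → i < n → ∀ M : C, P M → Subsingleton (Ext.{w} M X i)) → P X)
    {X : C} (hX : ∀ i : ℕ, 1 ≤ i → i < n → ∀ M : C, P M → Subsingleton (Ext.{w} X M i))
    (k j : ℕ) (hj : 1 ≤ j) (hk : j + k + 1 = n) (K : C)
    (hK : ∀ i : ℕ, 1 ≤ i → i ≤ j → ∀ M : C, P M → Subsingleton (Ext.{w} M K i)) :
    Subsingleton (Ext.{w} X K j) := by
  induction k generalizing j K with
  | zero => exact hX j hj (by lia) K (right K fun i h₁ h₂ ↦ hK i h₁ (by lia))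
  | succ k ih =>
    obtain ⟨M, f, hM, hf⟩ := fin K
    have : Epi f := by
      obtain ⟨Y, g, hY, hg⟩ := gen K
      obtain ⟨h, rfl⟩ := hf Y hY g
      exact epi_of_epi h f
    let S := ShortComplex.mk _ _ (kernel.condition f)
    have hS : S.ShortExact := { exact := ShortComplex.exact_kernel f }
    refine Ext.subsingleton_X₃_right hS X j (hX j hj (by lia) M hM)
      (ih (j + 1) (by lia) (by lia) (kernel f) fun i h₁ h₂ N hN ↦ ?_)
    obtain ⟨i, rfl⟩ := Nat.exists_eq_add_of_le' h₁
    obtain rfl | hi := Nat.eq_zero_or_pos i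
    · exact Ext.subsingleton_X₁_one_right hS N (rigid _ le_rfl (by lia) N M hN hM)
        fun g ↦ hf N hN g
    · exact Ext.subsingleton_X₁_right hS N i (hK i hi (by lia) N hN)
        (rigid _ (by lia) (by lia) N M hN hM)

/-- For a generating, contravariantly finite `P` with `Ext^i(P, P) = 0` for `1 ≤ i < n`, one half of
the maximality of an `n`-cluster tilting subcategory follows from the other half: a right
`P`-approximation of `X` is an epimorphism with kernel `K` satisfying `Ext^1(X, K) = 0`, so it
splits. -/
theorem of_ext_left_of_generating (gen : P.IsGenerating) (fin : P.IsContravariantlyFinite)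
    (rigid : ∀ i : ℕ, 1 ≤ i → i < n → ∀ M N : C, P M → P N → Subsingleton (Ext.{w} M N i))
    (right : ∀ X : C, (∀ i : ℕ, 1 ≤ i → i < n → ∀ M : C, P M → Subsingleton (Ext.{w} M X i)) → P X)
    {X : C} (hX : ∀ i : ℕ, 1 ≤ i → i < n → ∀ M : C, P M → Subsingleton (Ext.{w} X M i)) :
    P X := by
  obtain hn | hn := le_or_gt n 1
  · exact right X fun i h₁ h₂ ↦ by lia
  obtain ⟨M, f, hM, hf⟩ := fin X
  have : Epi f := by
    obtain ⟨Y, g, hY, hg⟩ := gen X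
    obtain ⟨h, rfl⟩ := hf Y hY g
    exact epi_of_epi h f
  let S := ShortComplex.mk _ _ (kernel.condition f)
  have hS : S.ShortExact := { exact := ShortComplex.exact_kernel f }
  have h1 : Subsingleton (Ext.{w} X (kernel f) 1) := by
    refine ext_subsingleton_of_generating gen fin rigid right hX (n - 2) 1 le_rfl (by lia) _
      fun i h₁ h₂ N hN ↦ ?_
    obtain rfl : i = 1 := by lia
    exact Ext.subsingleton_X₁_one_right hS N (rigid _ le_rfl (by lia) N M hN hM) fun g ↦ hf N hN g
  obtain ⟨s, hs⟩ := Ext.exists_lift hS h1 (𝟙 X)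
  exact right X fun i h₁ h₂ N hN ↦ Ext.subsingleton_of_retract_right
    { i := s, r := f, retract := hs } (rigid i h₁ h₂ N M hN hM)

end CategoryTheory.ObjectProperty

/-! ### Matlis duality over a commutative artinian ring -/

/-- Every module embeds into an injective module as an essential submodule. The new module
`U` is a maximal essential extension inside some injective module `E₀`. It is a retract of `E₀`, hence
again injective: for a maximal `D` with `D ⊓ U = ⊥`, the inclusion of `U` extends to
`ψ : E₀ ⧸ D → E₀`, and the image of `ψ` is an essential extension of `U`. -/
theorem Module.exists_essential_embedding_baer (R : Type v) [Ring R] (S : Type v) [AddCommGroup S]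
    [Module R S] :
    ∃ (E : Type v) (_ : AddCommGroup E) (_ : Module R E) (j : S →ₗ[R] E), Module.Baer R E ∧
      Function.Injective j ∧ ∀ x : E, x ≠ 0 → ∃ r : R, r • x ∈ LinearMap.range j ∧ r • x ≠ 0 := by
  let E₀ : ModuleCat.{v} R := CategoryTheory.Injective.under (ModuleCat.of R S)
  let j₀ : S →ₗ[R] E₀ := (CategoryTheory.Injective.ι (ModuleCat.of R S)).hom
  have hj₀ : Function.Injective j₀ := (ModuleCat.mono_iff_injective _).1 inferInstance
  have hE₀ : Module.Baer R E₀ := by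
    refine Module.Baer.of_injective ?_
    have : CategoryTheory.Injective (ModuleCat.of R E₀) :=
      inferInstanceAs (CategoryTheory.Injective E₀)
    exact Module.injective_module_of_injective_object R E₀
  let T := LinearMap.range j₀
  let 𝒰 : Set (Submodule R E₀) :=
    {U | T ≤ U ∧ ∀ x ∈ U, x ≠ 0 → ∃ r : R, r • x ∈ T ∧ r • x ≠ 0}
  obtain ⟨U, hTU, hU⟩ := zorn_le_nonempty₀ 𝒰 (fun c hc hchain U hU ↦ by
    refine ⟨sSup c, ⟨(hc hU).1.trans (le_sSup hU), fun x hx ↦ ?_⟩, fun V hV ↦ le_sSup hV⟩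
    obtain ⟨V, hV, hxV⟩ := (Submodule.mem_sSup_of_directed ⟨U, hU⟩ hchain.directedOn).1 hx
    exact (hc hV).2 x hxV) T ⟨le_rfl, fun x hx h ↦ ⟨1, by simpa using hx, by simpa using h⟩⟩
  let 𝒞 : Set (Submodule R E₀) := {D | ∀ x ∈ D, x ∈ U → x = 0}
  obtain ⟨D, -, hD⟩ := zorn_le_nonempty₀ 𝒞 (fun c hc hchain V hV ↦ by
    refine ⟨sSup c, fun x hx ↦ ?_, fun V hV ↦ le_sSup hV⟩
    obtain ⟨V, hV, hxV⟩ := (Submodule.mem_sSup_of_directed ⟨V, hV⟩ hchain.directedOn).1 hx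
    exact hc hV x hxV) ⊥ (fun x hx _ ↦ by simpa using hx)
  let q : U →ₗ[R] E₀ ⧸ D := D.mkQ ∘ₗ U.subtype
  have hq : Function.Injective q := by
    rw [injective_iff_map_eq_zero]
    intro x hx
    exact Subtype.ext (hD.1 x ((Submodule.Quotient.mk_eq_zero D).1 hx) x.2)
  -- The image of `U` in the quotient by a maximal complement is essential.
  have hess : ∀ y : E₀ ⧸ D, y ≠ 0 → ∃ (r : R) (u : U), r • y = q u ∧ u ≠ 0 := by
    intro y hy
    obtain ⟨x, rfl⟩ := D.mkQ_surjective y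
    by_contra! h
    have : D ⊔ R ∙ x ∈ 𝒞 := by
      intro z hz hzU
      obtain ⟨d, hd, w, hw, rfl⟩ := Submodule.mem_sup.1 hz
      obtain ⟨r, rfl⟩ := Submodule.mem_span_singleton.1 hw
      have := h r ⟨_, hzU⟩ (by
        simp only [q, LinearMap.comp_apply, Submodule.subtype_apply, map_add, map_smul]
        simp [(Submodule.Quotient.mk_eq_zero D).2 hd])
      exact congrArg Subtype.val this
    have hx := hD.2 this le_sup_left (Submodule.mem_sup_right (Submodule.mem_span_singleton_self x))
    exact hy ((Submodule.Quotient.mk_eq_zero D).2 hx)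
  obtain ⟨ψ, hψ⟩ := hE₀.extension_property q hq U.subtype
  have hψq : ∀ u, ψ (q u) = u := fun u ↦ LinearMap.congr_fun hψ u
  have hrange : LinearMap.range ψ ≤ U := by
    refine hU.2 ⟨hTU.trans fun u hu ↦ ⟨q ⟨u, hu⟩, hψq _⟩, ?_⟩ fun u hu ↦ ⟨q ⟨u, hu⟩, hψq _⟩
    rintro _ ⟨y, rfl⟩ hy
    obtain ⟨r, u, hru, hu⟩ := hess y (by rintro rfl; simp at hy)
    obtain ⟨s, hs, hs'⟩ := hU.1.2 u u.2 (by simpa using hu)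
    refine ⟨s * r, ?_⟩
    rw [mul_smul, ← map_smul, hru, hψq]
    exact ⟨hs, hs'⟩
  let p : E₀ →ₗ[R] U := (ψ ∘ₗ D.mkQ).codRestrict U fun x ↦ hrange ⟨_, rfl⟩
  refine ⟨U, inferInstance, inferInstance, j₀.codRestrict U fun s ↦ hTU ⟨s, rfl⟩, ?_, ?_, ?_⟩
  · intro I g
    obtain ⟨g', hg'⟩ := hE₀ I (U.subtype ∘ₗ g)
    refine ⟨p ∘ₗ g', fun x hx ↦ Subtype.ext ?_⟩
    have : g' x = g ⟨x, hx⟩ := hg' x hx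
    change ψ (D.mkQ (g' x)) = _
    rw [this]
    exact hψq _
  · exact fun a b h ↦ hj₀ (congrArg Subtype.val h)
  · intro x hx
    obtain ⟨r, ⟨s, hs⟩, h⟩ := hU.1.2 x x.2 (by simpa using hx)
    exact ⟨r, ⟨s, Subtype.ext hs⟩, fun h0 ↦ h (congrArg Subtype.val h0)⟩

/-- A Matlis module over a commutative ring `R`: an injective module `E` in which each simple
module `R ⧸ I` embeds, with `Hom(R ⧸ I, E)` cyclic (hence simple). Over an artinian ring,
`Hom(-, E)` is then a duality on the modules of finite length. -/
structure Module.IsMatlis (R : Type*) (E : Type*) [CommRing R] [AddCommGroup E] [Module R E] :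
    Prop where
  baer : Module.Baer R E
  exists_ne_zero (I : Ideal R) [I.IsMaximal] : ∃ φ : R ⧸ I →ₗ[R] E, φ ≠ 0
  exists_smul_eq (I : Ideal R) [I.IsMaximal] (φ ψ : R ⧸ I →ₗ[R] E) (hφ : φ ≠ 0) :
    ∃ r : R, r • φ = ψ

/-- An essential injective extension of the product of all simple modules `R ⧸ I` is a Matlis
module. -/
theorem Module.exists_isMatlis (R : Type v) [CommRing R] :
    ∃ (E : Type v) (_ : AddCommGroup E) (_ : Module R E), Module.IsMatlis R E := by
  obtain ⟨E, _, _, j, hE, hj, hess⟩ :=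
    Module.exists_essential_embedding_baer R ((I : MaximalSpectrum R) → R ⧸ I.asIdeal)
  classical
  refine ⟨E, _, _, hE, fun I hI ↦ ?_, fun I hI φ ψ hφ ↦ ?_⟩
  · refine ⟨j ∘ₗ LinearMap.single R (fun I : MaximalSpectrum R ↦ R ⧸ I.asIdeal) ⟨I, hI⟩,
      fun h ↦ ?_⟩
    have h1 := LinearMap.congr_fun h 1
    rw [LinearMap.comp_apply, LinearMap.zero_apply, map_eq_zero_iff j hj] at h1
    have h2 := congrFun h1 ⟨I, hI⟩
    simp only [LinearMap.coe_single, Pi.single_eq_same, Pi.zero_apply] at h2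
    exact hI.ne_top ((Ideal.Quotient.zero_eq_one_iff).1 h2.symm)
  -- a nonzero map lands in the product of the simple modules, on the coordinate `I`
  have key : ∀ χ : R ⧸ I →ₗ[R] E, ∃ t : (I : MaximalSpectrum R) → R ⧸ I.asIdeal, χ 1 = j t := by
    intro χ
    by_cases hχ : χ 1 = 0
    · exact ⟨0, by simp [hχ]⟩
    obtain ⟨r, ⟨t, ht⟩, hr⟩ := hess _ hχ
    have hrI : r ∉ I := fun h ↦ hr <| by
      rw [← map_smul]
      have : r • (1 : R ⧸ I) = 0 := by
        rw [Algebra.smul_def, mul_one]; exact Ideal.Quotient.eq_zero_iff_mem.2 h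
      rw [this, map_zero]
    obtain ⟨s, hs⟩ := Ideal.IsMaximal.exists_inv hI hrI
    obtain ⟨i, hi, hs⟩ := hs
    refine ⟨s • t, ?_⟩
    rw [map_smul, ht, ← mul_smul, ← map_smul]
    congr 1
    rw [Algebra.smul_def, mul_one, eq_comm, ← map_one (algebraMap R (R ⧸ I))]
    refine Ideal.Quotient.eq.2 ?_
    have : s * r - 1 = -i := by linear_combination hs
    rw [this]; exact I.neg_mem hi
  have supp : ∀ (χ : R ⧸ I →ₗ[R] E) (t : (I : MaximalSpectrum R) → R ⧸ I.asIdeal), χ 1 = j t →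
      ∀ K : MaximalSpectrum R, K ≠ ⟨I, hI⟩ → t K = 0 := by
    intro χ t ht K hK
    obtain ⟨a, haI, haK⟩ : ∃ a ∈ I, a ∉ K.asIdeal := by
      by_contra! h
      exact hK (MaximalSpectrum.ext (hI.eq_of_le K.isMaximal.ne_top h).symm)
    have h0 : a • t = 0 := hj <| by
      rw [map_smul, ← ht, ← map_smul, map_zero, Algebra.smul_def, mul_one]
      have : algebraMap R (R ⧸ I) a = 0 := Ideal.Quotient.eq_zero_iff_mem.2 haI
      rw [this, map_zero]
    have h1 := congrFun h0 K
    rw [Pi.smul_apply, Pi.zero_apply, Algebra.smul_def] at h1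
    have := K.isMaximal.isPrime
    exact (mul_eq_zero.1 h1).resolve_left fun h ↦ haK (Ideal.Quotient.eq_zero_iff_mem.1 h)
  have ext1 : ∀ χ χ' : R ⧸ I →ₗ[R] E, χ 1 = χ' 1 → χ = χ' := by
    intro χ χ' h
    refine LinearMap.ext fun y ↦ ?_
    obtain ⟨a, rfl⟩ := Ideal.Quotient.mk_surjective y
    have : Ideal.Quotient.mk I a = a • (1 : R ⧸ I) := by rw [Algebra.smul_def, mul_one]; rfl
    rw [this, map_smul, map_smul, h]
  obtain ⟨t, ht⟩ := key φ
  obtain ⟨t', ht'⟩ := key ψ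
  have htI : t ⟨I, hI⟩ ≠ 0 := fun h0 ↦ hφ <| ext1 _ _ <| by
    have : t = 0 := funext fun K ↦ by
      by_cases hK : K = ⟨I, hI⟩
      · subst hK; exact h0
      · exact supp φ t ht K hK
    rw [ht, this, map_zero, LinearMap.zero_apply]
  let := Ideal.Quotient.field I
  obtain ⟨c, hc⟩ := Ideal.Quotient.mk_surjective (t' ⟨I, hI⟩ * (t ⟨I, hI⟩)⁻¹ : R ⧸ I)
  refine ⟨c, ext1 _ _ ?_⟩
  rw [LinearMap.smul_apply, ht, ht', ← map_smul]
  congr 1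
  funext K
  by_cases hK : K = ⟨I, hI⟩
  · subst hK
    rw [Pi.smul_apply, Algebra.smul_def]
    change Ideal.Quotient.mk I c * _ = _
    rw [hc, mul_assoc, inv_mul_cancel₀ htI, mul_one]
  · rw [Pi.smul_apply, supp φ t ht K hK, supp ψ t' ht' K hK, smul_zero]

namespace Module.IsMatlis

variable {R E : Type*} [CommRing R] [AddCommGroup E] [Module R E] (hE : Module.IsMatlis R E)
include hE

theorem exists_apply_ne_zero {M : Type*} [AddCommGroup M] [Module R M] {x : M} (hx : x ≠ 0) :
    ∃ φ : M →ₗ[R] E, φ x ≠ 0 := by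
  let g := LinearMap.toSpanSingleton R M x
  have hg : LinearMap.ker g ≠ ⊤ := fun h ↦ hx <| by
    have : (1 : R) ∈ LinearMap.ker g := h ▸ Submodule.mem_top
    simpa [g] using this
  obtain ⟨I, hI, hle⟩ := Ideal.exists_le_maximal _ hg
  obtain ⟨φ, hφ⟩ := hE.exists_ne_zero I
  have hφ1 : φ 1 ≠ 0 := fun h ↦ hφ <| LinearMap.ext fun y ↦ by
    obtain ⟨a, rfl⟩ := Ideal.Quotient.mk_surjective y
    have : Ideal.Quotient.mk I a = a • (1 : R ⧸ I) := by rw [Algebra.smul_def, mul_one]; rfl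
    rw [this, map_smul, h, smul_zero, LinearMap.zero_apply]
  let k : (R ⧸ LinearMap.ker g) →ₗ[R] M := (LinearMap.ker g).liftQ g le_rfl
  obtain ⟨ψ, hψ⟩ := hE.baer.extension_property k
    (LinearMap.ker_eq_bot.1 (Submodule.ker_liftQ_eq_bot _ _ _ le_rfl))
    (φ ∘ₗ Submodule.mapQ _ I LinearMap.id hle)
  refine ⟨ψ, ?_⟩
  have := LinearMap.congr_fun hψ (Submodule.Quotient.mk 1)
  simp only [LinearMap.comp_apply, k, Submodule.liftQ_apply, g, LinearMap.toSpanSingleton_apply,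
    one_smul] at this
  rw [this]
  exact hφ1

theorem exists_apply_ne_zero_of_notMem {M : Type*} [AddCommGroup M] [Module R M]
    {N : Submodule R M} {x : M} (hx : x ∉ N) :
    ∃ φ : M →ₗ[R] E, (∀ y ∈ N, φ y = 0) ∧ φ x ≠ 0 := by
  obtain ⟨φ, hφ⟩ := hE.exists_apply_ne_zero (x := N.mkQ x) (by simpa using hx)
  exact ⟨φ ∘ₗ N.mkQ, fun y hy ↦ by simp [(Submodule.Quotient.mk_eq_zero N).2 hy], hφ⟩

theorem length_hom_le {M : Type*} [AddCommGroup M] [Module R M] (h : IsFiniteLength R M) :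
    Module.length R (M →ₗ[R] E) ≤ Module.length R M := by
  induction h with
  | of_subsingleton => simp [Module.length_eq_zero]
  | @of_simple_quotient M _ _ N _ hN ih =>
    have h1 : Module.length R (M ⧸ N →ₗ[R] E) ≤ 1 := by
      rcases subsingleton_or_nontrivial (M ⧸ N →ₗ[R] E) with h | h
      · simp [Module.length_eq_zero]
      have : IsSimpleModule R (M ⧸ N →ₗ[R] E) := by
        rw [isSimpleModule_iff_toSpanSingleton_surjective]
        refine ⟨h, fun φ hφ ψ ↦ ?_⟩
        obtain ⟨I, hI, ⟨e⟩⟩ := isSimpleModule_iff_quot_maximal.1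
          (inferInstance : IsSimpleModule R (M ⧸ N))
        obtain ⟨r, hr⟩ := hE.exists_smul_eq I (φ ∘ₗ e.symm.toLinearMap) (ψ ∘ₗ e.symm.toLinearMap)
          fun h0 ↦ hφ <| LinearMap.ext fun y ↦ by simpa using LinearMap.congr_fun h0 (e y)
        exact ⟨r, LinearMap.ext fun y ↦ by simpa using LinearMap.congr_fun hr (e y)⟩
      exact (Module.length_eq_one R (M ⧸ N →ₗ[R] E)).le
    have hex := Module.length_eq_add_of_exact (LinearMap.lcomp R E N.mkQ)
      (LinearMap.lcomp R E N.subtype)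
      (fun φ ψ hφ ↦ LinearMap.ext fun y ↦ by
        obtain ⟨y, rfl⟩ := N.mkQ_surjective y
        exact LinearMap.congr_fun hφ y)
      (fun φ ↦ hE.baer.extension_property _ N.injective_subtype φ)
      (fun φ ↦ ⟨fun h ↦ ⟨N.liftQ φ fun y hy ↦ LinearMap.congr_fun h ⟨y, hy⟩, by
          ext y; rfl⟩, by
        rintro ⟨ψ, rfl⟩
        ext y
        simp [(Submodule.Quotient.mk_eq_zero N).2 y.2]⟩)
    have hex' := Module.length_eq_add_of_exact N.subtype N.mkQ N.injective_subtype
      N.mkQ_surjective (LinearMap.exact_subtype_mkQ N)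
    rw [hex, hex', add_comm, Module.length_eq_one R (M ⧸ N)]
    exact add_le_add ih h1

theorem isFiniteLength_hom {M : Type*} [AddCommGroup M] [Module R M] (h : IsFiniteLength R M) :
    IsFiniteLength R (M →ₗ[R] E) :=
  Module.length_ne_top_iff.1
    (ne_top_of_le_ne_top (Module.length_ne_top_iff.2 h) (hE.length_hom_le h))

/-- Reflexivity of modules of finite length under Matlis duality: evaluation is injective because
`E` is a cogenerator, and surjective by comparison of lengths. -/
theorem exists_eval_eq {M : Type*} [AddCommGroup M] [Module R M] (h : IsFiniteLength R M)
    (τ : (M →ₗ[R] E) →ₗ[R] E) : ∃ x : M, ∀ φ : M →ₗ[R] E, τ φ = φ x := by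
  let ev : M →ₗ[R] (M →ₗ[R] E) →ₗ[R] E := LinearMap.applyₗ
  have hev : Function.Injective ev := by
    rw [injective_iff_map_eq_zero]
    intro x hx
    by_contra h0
    obtain ⟨φ, hφ⟩ := hE.exists_apply_ne_zero h0
    exact hφ (LinearMap.congr_fun hx φ)
  have hlen := (hE.length_hom_le (hE.isFiniteLength_hom h)).trans (hE.length_hom_le h)
  have hex := Module.length_eq_add_of_exact ev (LinearMap.range ev).mkQ hev
    (Submodule.mkQ_surjective _) (LinearMap.exact_map_mkQ_range ev)
  rw [hex] at hlen
  have h0 : Module.length R (((M →ₗ[R] E) →ₗ[R] E) ⧸ LinearMap.range ev) = 0 := by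
    have := Module.length_ne_top_iff.2 h
    rw [← nonpos_iff_eq_zero]
    exact (ENat.add_le_add_iff_left this).1 (by simpa using hlen)
  have htop := Submodule.Quotient.subsingleton_iff.1 (Module.length_eq_zero_iff.1 h0)
  obtain ⟨x, rfl⟩ := LinearMap.range_eq_top.1 htop τ
  exact ⟨x, fun φ ↦ rfl⟩

end Module.IsMatlis

/-! ### Split monomorphisms into products -/

section Duality

variable {R : Type v} {A : Type u} [CommRing R] [IsArtinianRing R] [Ring A] [Algebra R A]
  [Module.Finite R A]

/-- A linear presentation of `Hom_A(-, L)` for a finitely generated module `L`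
over an artin algebra. Let `D = Hom_R(-, E)`. Generators `ξ₁, …, ξₚ` of the right `A`-module `D L`
and generators `c₁, …, c_q` of their relations identify `Hom_A(N, L)`, for every `N`, with the
`R`-linear maps `Nᵖ → E` vanishing on the image of the matrix `c : N^q → Nᵖ`: this is
`Hom_A(N, L) = Hom_A(N, D D L) = D (D L ⊗ N)`. -/
theorem Module.IsMatlis.exists_presentation {E : Type v} [AddCommGroup E] [Module R E]
    (hE : Module.IsMatlis R E) (L : Type u) [AddCommGroup L] [Module A L] [Module R L]
    [IsScalarTower R A L] [Module.Finite A L] :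
    ∃ (p q : ℕ) (c : Fin q → Fin p → A) (ξ : Fin p → L →ₗ[R] E),
      (∀ s (x : L), ∑ l, ξ l (c s l • x) = 0) ∧ (∀ x : L, (∀ l, ξ l x = 0) → x = 0) ∧
      ∀ (N : Type u) [AddCommGroup N] [Module A N] [Module R N] [IsScalarTower R A N]
        (h : (Fin p → N) →ₗ[R] E), (∀ s (y : N), h (fun l ↦ c s l • y) = 0) →
        ∃ r : N →ₗ[A] L, ∀ y : Fin p → N, h y = ∑ l, ξ l (r (y l)) := by
  have : Module.Finite R L := Module.Finite.trans A L
  have hL : IsFiniteLength R L := isFiniteLength_iff_isNoetherian_isArtinian.2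
    ⟨isNoetherian_of_isNoetherianRing_of_finite R L, inferInstance⟩
  have hDL := isFiniteLength_iff_isNoetherian_isArtinian.1 (hE.isFiniteLength_hom hL)
  have := hDL.1
  obtain ⟨p, ξ, hξ⟩ := Module.Finite.exists_fin (R := R) (M := L →ₗ[R] E)
  have hsep : ∀ x : L, (∀ l, ξ l x = 0) → x = 0 := by
    intro x hx
    by_contra h0
    obtain ⟨φ, hφ⟩ := hE.exists_apply_ne_zero h0
    have : Submodule.span R (Set.range ξ) ≤ LinearMap.ker (LinearMap.applyₗ (R := R) (M₂ := E) x) :=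
      Submodule.span_le.2 (by rintro _ ⟨l, rfl⟩; exact hx l)
    exact hφ (this (hξ ▸ Submodule.mem_top : φ ∈ _))
  let π : (Fin p → A) →ₗ[R] (L →ₗ[R] E) :=
    { toFun a := ∑ l, ξ l ∘ₗ Algebra.lsmul R R L (a l)
      map_add' a b := by ext x; simp [Finset.sum_add_distrib]
      map_smul' r a := by ext x; simp [Finset.smul_sum] }
  have hπ : ∀ a x, π a x = ∑ l, ξ l (a l • x) := fun a x ↦ by simp [π]
  have hπs : Function.Surjective π := by
    rw [← LinearMap.range_eq_top, ← top_le_iff, ← hξ, Submodule.span_le]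
    rintro _ ⟨l, rfl⟩
    refine ⟨Pi.single l 1, LinearMap.ext fun x ↦ ?_⟩
    rw [hπ, Finset.sum_eq_single l (fun b _ hb ↦ by simp [hb]) (by simp)]
    simp
  obtain ⟨q, c, hc⟩ := Module.Finite.exists_fin (R := R) (M := LinearMap.ker π)
  refine ⟨p, q, fun s ↦ c s, ξ, fun s x ↦ ?_, hsep, fun N _ _ _ _ h hh ↦ ?_⟩
  · rw [← hπ, (c s).2, LinearMap.zero_apply]
  -- for each `y`, the functional `∑ ξₗ aₗ ↦ h (aₗ y)ₗ` on `D L` is the evaluation at an element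
  let β (y : N) : (Fin p → A) →ₗ[R] E :=
    { toFun a := h fun l ↦ a l • y
      map_add' a b := by rw [← map_add]; congr 1; ext l; simp [add_smul]
      map_smul' r a := by
        rw [RingHom.id_apply, ← map_smul]; congr 1; ext l; simp }
  have hβ : ∀ y a, β y a = h fun l ↦ a l • y := fun _ _ ↦ rfl
  have hβker : ∀ y, LinearMap.ker π ≤ LinearMap.ker (β y) := by
    intro y a ha
    have : (⟨a, ha⟩ : LinearMap.ker π) ∈
        LinearMap.ker (β y ∘ₗ (LinearMap.ker π).subtype) := by
      have hle : Submodule.span R (Set.range c) ≤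
          LinearMap.ker (β y ∘ₗ (LinearMap.ker π).subtype) :=
        Submodule.span_le.2 (by rintro _ ⟨s, rfl⟩; exact hh s y)
      exact hle (hc ▸ Submodule.mem_top)
    exact this
  have hex : ∀ y : N, ∃ x : L, ∀ a : Fin p → A, β y a = ∑ l, ξ l (a l • x) := by
    intro y
    obtain ⟨x, hx⟩ := hE.exists_eval_eq hL (((LinearMap.ker π).liftQ (β y) (hβker y)) ∘ₗ
      (π.quotKerEquivOfSurjective hπs).symm.toLinearMap)
    refine ⟨x, fun a ↦ ?_⟩
    rw [← hπ, ← hx]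
    have : (π.quotKerEquivOfSurjective hπs).symm (π a) = Submodule.Quotient.mk a := by
      rw [LinearEquiv.symm_apply_eq]; rfl
    simp [this]
  have huniq : ∀ x x' : L, (∀ a : Fin p → A, ∑ l, ξ l (a l • x) = ∑ l, ξ l (a l • x')) →
      x = x' := by
    intro x x' hx
    rw [← sub_eq_zero]
    refine hsep _ fun l ↦ ?_
    have := hx (Pi.single l 1)
    rw [Finset.sum_eq_single l (fun b _ hb ↦ by simp [hb]) (by simp),
      Finset.sum_eq_single l (fun b _ hb ↦ by simp [hb]) (by simp)] at this
    simpa [sub_eq_zero] using this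
  choose r hr using hex
  refine ⟨⟨⟨r, fun y z ↦ huniq _ _ fun a ↦ ?_⟩, fun b y ↦ huniq _ _ fun a ↦ ?_⟩, fun y ↦ ?_⟩
  · simp only [smul_add, map_add, Finset.sum_add_distrib, ← hr, hβ]
    rw [← map_add]; rfl
  · have := hr y fun l ↦ a l * b
    simp only [mul_smul] at this
    rw [← hr]
    simpa [hβ, mul_smul] using this
  · have hy : y = ∑ l, (fun l' ↦ (Pi.single l 1 : Fin p → A) l' • y l) := by
      ext l'
      rw [Finset.sum_apply, Finset.sum_eq_single l' (fun b _ hb ↦ by simp [hb.symm]) (by simp)]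
      simp
    conv_lhs => rw [hy, map_sum]
    refine Finset.sum_congr rfl fun l _ ↦ ?_
    rw [← hβ, hr, Finset.sum_eq_single l (fun b _ hb ↦ by simp [hb]) (by simp)]
    simp

/-- Over an artin algebra, the finitely generated module `L` is seen by products only through
finitely many factors: if `f : L → ∏ N i` is a split monomorphism, then the endomorphisms of `L`
factoring through some component `f i` generate the unit left ideal of `End L`. This replaces the
existence of left almost split morphisms: an endomorphism outside the span of those factorizations
is detected by a tuple `x ∈ Lᵖ`, and being in the image of a finite matrix `c` is a condition
which `f x` satisfies as soon as all `f i x` do. -/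
theorem Ideal.span_endomorphisms_eq_top_of_split_pi (R : Type v) {A : Type u} [CommRing R]
    [IsArtinianRing R] [Ring A] [Algebra R A] [Module.Finite R A] {L : Type u} [AddCommGroup L]
    [Module A L] [Module.Finite A L]
    {ι : Type u} {N : ι → Type u} [∀ i, AddCommGroup (N i)] [∀ i, Module A (N i)]
    (f : ∀ i, L →ₗ[A] N i) (r : (∀ i, N i) →ₗ[A] L) (hr : r ∘ₗ LinearMap.pi f = LinearMap.id) :
    Ideal.span {φ : Module.End A L | ∃ (i : ι) (g : N i →ₗ[A] L), φ = g ∘ₗ f i} = ⊤ := by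
  let : Module R L := Module.compHom L (algebraMap R A)
  let : ∀ i, Module R (N i) := fun i ↦ Module.compHom (N i) (algebraMap R A)
  have hLA : IsScalarTower R A L := ⟨fun a b x ↦ by
    rw [Algebra.smul_def, mul_smul]; rfl⟩
  have : ∀ i, IsScalarTower R A (N i) := fun i ↦ ⟨fun a b x ↦ by
    rw [Algebra.smul_def, mul_smul]; rfl⟩
  have : IsScalarTower R A (∀ i, N i) := ⟨fun a b x ↦ funext fun i ↦ smul_assoc a b (x i)⟩
  obtain ⟨E, _, _, hE⟩ := Module.exists_isMatlis R
  obtain ⟨p, q, c, ξ, hcξ, hsep, hpres⟩ := hE.exists_presentation (A := A) L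
  set I := Ideal.span {φ : Module.End A L | ∃ (i : ι) (g : N i →ₗ[A] L), φ = g ∘ₗ f i} with hI
  rw [Ideal.eq_top_iff_one]
  by_contra h1
  have : Module.Finite R L := Module.Finite.trans A L
  -- the image of the matrix `c`
  let W (N : Type u) [AddCommGroup N] [Module A N] [Module R N] [IsScalarTower R A N] :
      Submodule R (Fin p → N) :=
    LinearMap.range (LinearMap.pi (fun l ↦ ∑ s : Fin q,
      Algebra.lsmul R R N (c s l) ∘ₗ LinearMap.proj s) : (Fin q → N) →ₗ[R] (Fin p → N))
  have hW : ∀ (N : Type u) [AddCommGroup N] [Module A N] [Module R N] [IsScalarTower R A N]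
      (x : Fin p → N), x ∈ W N ↔ ∃ y : Fin q → N, ∀ l, ∑ s, c s l • y s = x l := by
    intro N _ _ _ _ x
    constructor
    · rintro ⟨y, rfl⟩
      exact ⟨y, fun l ↦ by simp⟩
    · rintro ⟨y, hy⟩
      exact ⟨y, by ext l; simp [← hy]⟩
  have hξW : ∀ (N : Type u) [AddCommGroup N] [Module A N] [Module R N] [IsScalarTower R A N]
      (r : N →ₗ[A] L) (x : Fin p → N), x ∈ W N → ∑ l, ξ l (r (x l)) = 0 := by
    intro N _ _ _ _ r x hx
    obtain ⟨y, hy⟩ := (hW N x).1 hx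
    simp only [← hy, map_sum, map_smul]
    rw [Finset.sum_comm]
    exact Finset.sum_eq_zero fun s _ ↦ hcξ s _
  let Q := (Fin p → L) ⧸ W L
  have hQ : IsFiniteLength R Q := isFiniteLength_iff_isNoetherian_isArtinian.2
    ⟨isNoetherian_of_isNoetherianRing_of_finite R Q, inferInstance⟩
  let θ₀ (φ : Module.End A L) : (Fin p → L) →ₗ[R] E :=
    ∑ l, ξ l ∘ₗ φ.restrictScalars R ∘ₗ LinearMap.proj l
  have hθ₀ : ∀ φ x, θ₀ φ x = ∑ l, ξ l (φ (x l)) := fun φ x ↦ by simp [θ₀]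
  let θ : Module.End A L →ₗ[R] (Q →ₗ[R] E) :=
    { toFun φ := (W L).liftQ (θ₀ φ) fun x hx ↦ by
        rw [LinearMap.mem_ker, hθ₀]; exact hξW L φ x hx
      map_add' φ ψ := by
        refine Submodule.linearMap_qext _ (LinearMap.ext fun x ↦ ?_)
        simp [hθ₀, Finset.sum_add_distrib]
      map_smul' a φ := by
        refine Submodule.linearMap_qext _ (LinearMap.ext fun x ↦ ?_)
        simp [hθ₀, Finset.smul_sum] }
  have hθ : ∀ φ x, θ φ ((W L).mkQ x) = ∑ l, ξ l (φ (x l)) := fun φ x ↦ hθ₀ φ x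
  have hθb : Function.Bijective θ := by
    constructor
    · rw [injective_iff_map_eq_zero]
      intro φ hφ
      refine LinearMap.ext fun x ↦ hsep _ fun l ↦ ?_
      have := hθ φ (Pi.single l x)
      rw [hφ, Finset.sum_eq_single l (fun b _ hb ↦ by simp [hb]) (by simp)] at this
      simpa using this.symm
    · intro h
      obtain ⟨φ, hφ⟩ := hpres L (h ∘ₗ (W L).mkQ) fun s y ↦ by
        have : (fun l ↦ c s l • y) ∈ W L := (hW L _).2 ⟨Pi.single s y, fun l ↦ by
          rw [Finset.sum_eq_single s (fun b _ hb ↦ by simp [hb]) (by simp)]; simp⟩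
        have h0 : (W L).mkQ (fun l ↦ c s l • y) = 0 := (Submodule.Quotient.mk_eq_zero _).2 this
        rw [LinearMap.comp_apply, h0, map_zero]
      refine ⟨φ, Submodule.linearMap_qext _ (LinearMap.ext fun x ↦ ?_)⟩
      exact (hθ φ x).trans (hφ x).symm
  let Θ := LinearEquiv.ofBijective θ hθb
  -- a functional separating the identity from the left ideal is evaluation at a tuple
  obtain ⟨τ, hτ, hτ1⟩ := hE.exists_apply_ne_zero_of_notMem (N := I.restrictScalars R) h1
  obtain ⟨x, hx⟩ := hE.exists_eval_eq hQ (τ ∘ₗ Θ.symm.toLinearMap)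
  obtain ⟨x, rfl⟩ := (W L).mkQ_surjective x
  have hτx : ∀ φ, τ φ = ∑ l, ξ l (φ (x l)) := by
    intro φ
    have := hx (Θ φ)
    rw [LinearMap.comp_apply, LinearEquiv.coe_coe, LinearEquiv.symm_apply_apply] at this
    rw [this]
    exact hθ φ x
  have hxi : ∀ i, (fun l ↦ f i (x l)) ∈ W (N i) := by
    intro i
    by_contra hn
    obtain ⟨h, hh, hh1⟩ := hE.exists_apply_ne_zero_of_notMem hn
    obtain ⟨g, hg⟩ := hpres (N i) h fun s y ↦ hh _ <| (hW _ _).2 ⟨Pi.single s y, fun l ↦ by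
      rw [Finset.sum_eq_single s (fun b _ hb ↦ by simp [hb]) (by simp)]; simp⟩
    apply hh1
    rw [hg]
    have := hτ (g ∘ₗ f i) (Ideal.subset_span ⟨i, g, rfl⟩)
    rw [hτx] at this
    exact this
  choose y hy using fun i ↦ (hW (N i) _).1 (hxi i)
  have hfx : (fun l ↦ LinearMap.pi f (x l)) ∈ W (∀ i, N i) :=
    (hW _ _).2 ⟨fun s i ↦ y i s, fun l ↦ funext fun i ↦ by
      rw [Finset.sum_apply]; exact hy i l⟩
  apply hτ1
  rw [hτx, ← hξW _ r _ hfx]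
  refine Finset.sum_congr rfl fun l _ ↦ ?_
  rw [← LinearMap.comp_apply, hr]
  rfl

end Duality

/-! ### Indecomposable modules of finite length -/

/-- A nonzero module that is not the direct sum of two nonzero submodules. -/
def Module.IsIndecomposable (A : Type*) (L : Type*) [Ring A] [AddCommGroup L] [Module A L] : Prop :=
  Nontrivial L ∧ ∀ p q : Submodule A L, IsCompl p q → p = ⊥ ∨ q = ⊥

section Indecomposable

variable {A : Type u} [Ring A]

namespace Module.IsIndecomposable

variable {L : Type*} [AddCommGroup L] [Module A L]

/-- Fitting's lemma. -/
theorem isUnit_or_isNilpotent [IsNoetherian A L] [IsArtinian A L]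
    (hL : Module.IsIndecomposable A L) (φ : Module.End A L) : IsUnit φ ∨ IsNilpotent φ := by
  obtain ⟨k, hk⟩ := Filter.eventually_atTop.1 φ.eventually_isCompl_ker_pow_range_pow
  have hc := hk (k + 1) (by lia)
  rcases hL.2 _ _ hc with h | h
  · left
    have h' : LinearMap.range (φ ^ (k + 1)) = ⊤ := by simpa [h] using hc.sup_eq_top
    rw [← isUnit_pow_succ_iff (n := k), Module.End.isUnit_iff]
    exact ⟨LinearMap.ker_eq_bot.1 h, LinearMap.range_eq_top.1 h'⟩
  · exact Or.inr ⟨k + 1, LinearMap.range_eq_bot.1 h⟩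

/-- A family generating the unit left ideal of the endomorphism ring contains a unit: the
endomorphism ring is local. -/
theorem exists_isUnit_of_span_eq_top [IsNoetherian A L] [IsArtinian A L]
    (hL : Module.IsIndecomposable A L) {S : Set (Module.End A L)} (hS : Ideal.span S = ⊤) :
    ∃ φ ∈ S, IsUnit φ := by
  by_contra! h
  have hloc : ∀ a b : Module.End A L, IsUnit (a + b) → IsUnit a ∨ IsUnit b := by
    rintro a b ⟨u, hu⟩
    have hsum : ↑u⁻¹ * a = 1 - ↑u⁻¹ * b := by
      rw [eq_sub_iff_add_eq, ← mul_add, ← hu, Units.inv_mul]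
    rcases hL.isUnit_or_isNilpotent (↑u⁻¹ * b) with hb | hb
    · exact Or.inr ((Units.isUnit_units_mul u⁻¹ b).1 hb)
    · exact Or.inl ((Units.isUnit_units_mul u⁻¹ a).1 (hsum ▸ hb.isUnit_one_sub))
  have hmul : ∀ a b : Module.End A L, IsUnit (a * b) → IsUnit b := by
    intro a b hab
    rcases hL.isUnit_or_isNilpotent b with hb | ⟨k, hk⟩
    · exact hb
    have hinj : Function.Injective b := fun x y hxy ↦
      ((Module.End.isUnit_iff _).1 hab).1 (by simp [hxy])
    have hinj' : Function.Injective (b ^ k) := by rw [Module.End.coe_pow]; exact hinj.iterate k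
    have := hL.1
    obtain ⟨x, hx⟩ := exists_ne (0 : L)
    exact absurd (@hinj' x 0 (by simp [hk])) hx
  let I : Ideal (Module.End A L) :=
    { carrier := {φ | ¬ IsUnit φ}
      add_mem' := fun {a b} ha hb hab ↦ (hloc a b hab).elim ha hb
      zero_mem' := by
        have := hL.1
        exact not_isUnit_zero
      smul_mem' := fun a b hb hab ↦ hb (hmul a b hab) }
  have : Ideal.span S ≤ I := Ideal.span_le.2 h
  rw [hS] at this
  exact this (Submodule.mem_top (x := 1)) isUnit_one

/-- A nonzero split submodule of an indecomposable module is everything. -/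
theorem bijective_of_leftInverse {N : Type*} [AddCommGroup N] [Module A N]
    (hL : Module.IsIndecomposable A L) [Nontrivial N] (f : N →ₗ[A] L) (g : L →ₗ[A] N)
    (h : g ∘ₗ f = LinearMap.id) : Function.Bijective f := by
  have hgf : ∀ x, g (f x) = x := LinearMap.congr_fun h
  have hf : Function.Injective f := Function.LeftInverse.injective hgf
  refine ⟨hf, ?_⟩
  have hc : IsCompl (LinearMap.range f) (LinearMap.ker g) := by
    refine ⟨Submodule.disjoint_def.2 ?_, codisjoint_iff.2 (eq_top_iff.2 fun x _ ↦ ?_)⟩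
    · rintro _ ⟨x, rfl⟩ hx
      rw [LinearMap.mem_ker, hgf] at hx
      rw [hx, map_zero]
    · rw [Submodule.mem_sup]
      exact ⟨f (g x), ⟨_, rfl⟩, x - f (g x), by simp [hgf], by simp⟩
  rcases hL.2 _ _ hc with h0 | h0
  · obtain ⟨x, hx⟩ := exists_ne (0 : N)
    rw [LinearMap.range_eq_bot] at h0
    exact absurd (hf (by simp [h0] : f x = f 0)) hx
  · rw [h0] at hc
    exact LinearMap.range_eq_top.1 (by simpa using hc.sup_eq_top)

end Module.IsIndecomposable

/-- A property of modules of finite length holds as soon as it holds for zero and for indecomposable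
modules, and passes from two complementary submodules to the whole module. -/
theorem Module.induction_on_indecomposable
    {P : ∀ (X : Type w) [AddCommGroup X] [Module A X], Prop}
    (zero : ∀ (X : Type w) [AddCommGroup X] [Module A X], Subsingleton X → P X)
    (indec : ∀ (X : Type w) [AddCommGroup X] [Module A X], Module.Finite A X →
      Module.IsIndecomposable A X → P X)
    (sum : ∀ (X : Type w) [AddCommGroup X] [Module A X] (p q : Submodule A X), IsCompl p q →
      P p → P q → P X)
    (X : Type w) [AddCommGroup X] [Module A X] [IsNoetherian A X] [IsArtinian A X] : P X := by
  suffices H : ∀ (k : ℕ) (X : Type w) [AddCommGroup X] [Module A X] [IsNoetherian A X]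
      [IsArtinian A X], Module.length A X ≤ k → P X by
    obtain ⟨k, hk⟩ := ENat.ne_top_iff_exists.1 (Module.length_ne_top (R := A) (M := X))
    exact H k X hk.ge
  intro k
  induction k with
  | zero =>
    intro X _ _ _ _ h
    exact zero X (Module.length_eq_zero_iff.1 (nonpos_iff_eq_zero.1 h))
  | succ k ih =>
    intro X _ _ _ _ h
    rcases subsingleton_or_nontrivial X with hX | hX
    · exact zero X hX
    by_cases hI : Module.IsIndecomposable A X
    · exact indec X inferInstance hI
    simp only [Module.IsIndecomposable, not_and, not_forall, not_or] at hI
    obtain ⟨p, q, hpq, hp, hq⟩ := hI hX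
    have hlt : ∀ p : Submodule A X, p ≠ ⊤ → P p := fun p hp ↦ ih p <| by
      have := (Submodule.length_lt hp).trans_le h
      exact ENat.lt_add_one_iff (by simp) |>.1 (by simpa using this)
    refine sum X p q hpq (hlt p fun h0 ↦ hq ?_) (hlt q fun h0 ↦ hp ?_)
    · rw [h0] at hpq; simpa using hpq.inf_eq_bot
    · rw [h0] at hpq; simpa using hpq.inf_eq_bot

/-- Every nonzero module of finite length has an indecomposable direct summand. -/
theorem Module.exists_isIndecomposable_retract (X : Type w) [AddCommGroup X] [Module A X]
    [IsNoetherian A X] [IsArtinian A X] [Nontrivial X] :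
    ∃ (L : Type w) (_ : AddCommGroup L) (_ : Module A L) (i : L →ₗ[A] X) (r : X →ₗ[A] L),
      Module.Finite A L ∧ Module.IsIndecomposable A L ∧ r ∘ₗ i = LinearMap.id := by
  refine Module.induction_on_indecomposable
    (P := fun X _ _ ↦ Nontrivial X → ∃ (L : Type w) (_ : AddCommGroup L) (_ : Module A L)
      (i : L →ₗ[A] X) (r : X →ₗ[A] L),
      Module.Finite A L ∧ Module.IsIndecomposable A L ∧ r ∘ₗ i = LinearMap.id)
    (fun X _ _ h h' ↦ (not_nontrivial_iff_subsingleton.2 h h').elim)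
    (fun X _ _ hf hX _ ↦ ⟨X, _, _, LinearMap.id, LinearMap.id, hf, hX, rfl⟩)
    (fun X _ _ p q hpq hp hq hX ↦ ?_) X inferInstance
  have key : ∀ p q : Submodule A X, IsCompl p q → (∃ (L : Type w) (_ : AddCommGroup L)
      (_ : Module A L) (i : L →ₗ[A] p) (r : p →ₗ[A] L),
      Module.Finite A L ∧ Module.IsIndecomposable A L ∧ r ∘ₗ i = LinearMap.id) →
      ∃ (L : Type w) (_ : AddCommGroup L) (_ : Module A L) (i : L →ₗ[A] X) (r : X →ₗ[A] L),
      Module.Finite A L ∧ Module.IsIndecomposable A L ∧ r ∘ₗ i = LinearMap.id := by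
    rintro p q hpq ⟨L, _, _, i, r, h₁, h₂, h₃⟩
    refine ⟨L, _, _, p.subtype ∘ₗ i, r ∘ₗ p.projectionOnto q hpq, h₁, h₂, ?_⟩
    rw [← h₃]
    ext x
    simp [Submodule.projectionOnto_apply_left]
  by_cases h : p = ⊥
  · have : q = ⊤ := by rw [h] at hpq; simpa using hpq.sup_eq_top
    subst this
    exact key _ _ hpq.symm (hq Submodule.topEquiv.toEquiv.nontrivial)
  · exact key _ _ hpq (hp (Submodule.nontrivial_iff_ne_bot.2 h))

/-- A nonzero direct summand `C` of a direct sum of modules of finite length has a direct summand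
that is indecomposable of finite length: the composite `G → C → G` with a suitable finite partial
sum `G` fixes a nonzero element, and Fitting's lemma applies to it. -/
theorem Module.exists_isIndecomposable_retract_of_directSum [IsNoetherianRing A] [IsArtinianRing A]
    {ι : Type u} (F : ι → Type u) [∀ j, AddCommGroup (F j)] [∀ j, Module A (F j)]
    [∀ j, Module.Finite A (F j)] {C : Type u} [AddCommGroup C] [Module A C] [Nontrivial C]
    (i : C →ₗ[A] DirectSum ι F) (r : DirectSum ι F →ₗ[A] C) (hri : r ∘ₗ i = LinearMap.id) :
    ∃ (L : Type u) (_ : AddCommGroup L) (_ : Module A L) (a : L →ₗ[A] C) (b : C →ₗ[A] L),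
      Module.Finite A L ∧ Module.IsIndecomposable A L ∧ b ∘ₗ a = LinearMap.id := by
  classical
  obtain ⟨c, hc⟩ := exists_ne (0 : C)
  let S := DFinsupp.support (i c)
  let G := (j : S) → F j
  let π : DirectSum ι F →ₗ[A] G := LinearMap.pi fun j ↦ DirectSum.component A ι F j
  let κ : G →ₗ[A] DirectSum ι F :=
    ∑ j : S, DirectSum.lof A ι F j ∘ₗ LinearMap.proj j
  have hκπ : κ (π (i c)) = i c := by
    have h1 : κ (π (i c)) = ∑ j : S, DirectSum.lof A ι F j (i c j) := by
      simp [κ, π]; rfl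
    rw [h1, Finset.sum_coe_sort S (fun j ↦ DirectSum.lof A ι F j (i c j))]
    exact DirectSum.sum_support_of (i c)
  have hric : r (i c) = c := LinearMap.congr_fun hri c
  -- `α` fixes the nonzero element `π (i c)`, so the Fitting image of `α` is nonzero.
  let α : Module.End A G := π ∘ₗ i ∘ₗ r ∘ₗ κ
  have hα : α (π (i c)) = π (i c) := by simp [α, hκπ, hric]
  have hne : π (i c) ≠ 0 := fun h ↦ hc (by rw [← hric, ← hκπ, h, map_zero, map_zero])
  obtain ⟨k, hk⟩ := Filter.eventually_atTop.1 α.eventually_isCompl_ker_pow_range_pow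
  have hc' := hk (k + 1) (by lia)
  have hcomm : ∀ x, x ∈ LinearMap.range (α ^ (k + 1)) → α x ∈ LinearMap.range (α ^ (k + 1)) := by
    rintro _ ⟨x, rfl⟩
    exact ⟨α x, by rw [← Module.End.mul_apply, ← Module.End.mul_apply, ← pow_succ, ← pow_succ']⟩
  let I := LinearMap.range (α ^ (k + 1))
  let β : Module.End A I := α.restrict hcomm
  have hβ : Function.Injective β := by
    rw [injective_iff_map_eq_zero]
    rintro ⟨x, hx⟩ h0
    have hx0 : α x = 0 := congrArg Subtype.val h0
    have : x ∈ LinearMap.ker (α ^ (k + 1)) := by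
      rw [LinearMap.mem_ker, pow_succ, Module.End.mul_apply, hx0, map_zero]
    exact Subtype.ext (Submodule.disjoint_def.1 hc'.disjoint x this hx)
  have hβb : Function.Bijective β := ⟨hβ, IsArtinian.surjective_of_injective_endomorphism β hβ⟩
  have hmem : π (i c) ∈ I := ⟨π (i c), by
    have : ∀ m, (α ^ m) (π (i c)) = π (i c) := fun m ↦ by
      induction m with
      | zero => rfl
      | succ m ih => rw [pow_succ, Module.End.mul_apply, hα, ih]
    exact this _⟩
  have : Nontrivial I := ⟨⟨⟨_, hmem⟩, 0, fun h ↦ hne (congrArg Subtype.val h)⟩⟩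
  obtain ⟨L, _, _, a, b, h₁, h₂, h₃⟩ := Module.exists_isIndecomposable_retract (A := A) I
  let e := LinearEquiv.ofBijective β hβb
  let ρ : G →ₗ[A] I := I.projectionOnto _ hc'.symm
  refine ⟨L, _, _, r ∘ₗ κ ∘ₗ I.subtype ∘ₗ a, b ∘ₗ e.symm.toLinearMap ∘ₗ ρ ∘ₗ π ∘ₗ i, h₁, h₂, ?_⟩
  rw [← h₃]
  ext x
  have h4 : ρ (π (i (r (κ (a x : G))))) = e (a x) := by
    have : π (i (r (κ (a x : G)))) = (e (a x) : I) := rfl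
    rw [this]
    exact Submodule.projectionOnto_apply_left _ _
  simp only [LinearMap.comp_apply, Submodule.subtype_apply, h4, LinearEquiv.coe_coe,
    LinearEquiv.symm_apply_apply]

end Indecomposable

/-! ### Purity -/

section Purity

variable {A : Type u} [Ring A]

/-- A linear map `f : X → Y` is a pure epimorphism on finitely generated modules if every map from
a finitely generated module to `Y` lifts along `f`. Over a noetherian ring, for surjective `f`,
this is the usual purity of the kernel of `f`. -/
def LinearMap.IsPureEpi {X Y : Type*} [AddCommGroup X] [AddCommGroup Y] [Module A X] [Module A Y]
    (f : X →ₗ[A] Y) : Prop :=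
  ∀ (B : Type u) [AddCommGroup B] [Module A B] [Module.Finite A B] (g : B →ₗ[A] Y),
    ∃ h : B →ₗ[A] X, f ∘ₗ h = g

/-- To lift a map `B → X ⧸ p` from a finitely generated module to `X`, lift it along a finite free
cover `F → B` with kernel `K`, and correct the lift by a map `F → p` which agrees with it on `K`. -/
theorem Submodule.isPureEpi_mkQ_of_exists_correction [IsNoetherianRing A] {X : Type*}
    [AddCommGroup X] [Module A X] (p : Submodule A X)
    (hp : ∀ (k : ℕ) (K : Submodule A (Fin k → A)) (g : (Fin k → A) →ₗ[A] X),
      K ≤ p.comap g → ∃ g' : (Fin k → A) →ₗ[A] X, (∀ x, g' x ∈ p) ∧ ∀ x ∈ K, g' x = g x) :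
    p.mkQ.IsPureEpi := by
  intro B _ _ _ f
  obtain ⟨k, π, hπ⟩ := Module.Finite.exists_fin' A B
  obtain ⟨g, hg⟩ := Module.projective_lifting_property p.mkQ (f ∘ₗ π) p.mkQ_surjective
  obtain ⟨g', hg', hgg'⟩ := hp k (LinearMap.ker π) g fun x hx ↦ by
    rw [Submodule.mem_comap, ← p.ker_mkQ, LinearMap.mem_ker, ← LinearMap.comp_apply, hg,
      LinearMap.comp_apply, LinearMap.mem_ker.1 hx, map_zero]
  refine ⟨(LinearMap.ker π).liftQ (g - g') (fun x hx ↦ by simp [hgg' x hx]) ∘ₗ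
    (π.quotKerEquivOfSurjective hπ).symm.toLinearMap, ?_⟩
  refine LinearMap.ext fun b ↦ ?_
  obtain ⟨x, rfl⟩ := hπ b
  have h1 : (π.quotKerEquivOfSurjective hπ).symm (π x) = Submodule.Quotient.mk x := by
    rw [LinearEquiv.symm_apply_eq]; rfl
  have h2 : p.mkQ (g x) = f (π x) := LinearMap.congr_fun hg x
  have h3 : p.mkQ (g' x) = 0 := (Submodule.Quotient.mk_eq_zero p).2 (hg' x)
  simp only [LinearMap.comp_apply, LinearEquiv.coe_coe, h1, Submodule.liftQ_apply,
    LinearMap.sub_apply, map_sub, h2, h3, sub_zero]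

theorem Submodule.isPureEpi_mkQ_sSup [IsNoetherianRing A] {X : Type*} [AddCommGroup X] [Module A X]
    {c : Set (Submodule A X)} (hne : c.Nonempty) (hdir : DirectedOn (· ≤ ·) c)
    (hc : ∀ p ∈ c, p.mkQ.IsPureEpi) : (sSup c).mkQ.IsPureEpi := by
  refine Submodule.isPureEpi_mkQ_of_exists_correction _ fun k K g hK ↦ ?_
  -- the finitely generated image of `K` lies in one member of the directed family
  obtain ⟨p, hp, hKp⟩ : ∃ p ∈ c, K.map g ≤ p := by
    have hfg : (K.map g).FG := (IsNoetherian.noetherian K).map g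
    have hcomp := (Submodule.fg_iff_compact _).1 hfg
    rw [CompleteLattice.isCompactElement_iff_le_of_directed_sSup_le] at hcomp
    exact hcomp c hne hdir (Submodule.map_le_iff_le_comap.2 hK)
  obtain ⟨h, hh⟩ := hc p hp ((Fin k → A) ⧸ K)
    (K.mapQ p g (Submodule.map_le_iff_le_comap.1 hKp))
  refine ⟨g - h ∘ₗ K.mkQ, fun x ↦ le_sSup hp ?_, fun x hx ↦ by
    simp [(Submodule.Quotient.mk_eq_zero K).2 hx]⟩
  rw [← Submodule.Quotient.mk_eq_zero p]
  have := LinearMap.congr_fun hh (K.mkQ x)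
  simp only [LinearMap.comp_apply, Submodule.mkQ_apply, Submodule.mapQ_apply] at this
  simp [this]

/-- A map `y : L → Y` splits locally if every factorization through a finitely generated module
starts with a split monomorphism. -/
def LinearMap.IsLocallySplit {L Y : Type*} [AddCommGroup L] [AddCommGroup Y] [Module A L]
    [Module A Y] (y : L →ₗ[A] Y) : Prop :=
  ∀ (B : Type u) [AddCommGroup B] [Module A B] [Module.Finite A B] (g : L →ₗ[A] B) (h : B →ₗ[A] Y),
    h ∘ₗ g = y → ∃ σ : B →ₗ[A] L, σ ∘ₗ g = LinearMap.id

theorem LinearMap.IsLocallySplit.injective {L Y : Type u} [AddCommGroup L] [AddCommGroup Y]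
    [Module A L] [Module A Y] [Module.Finite A L] {y : L →ₗ[A] Y} (hy : y.IsLocallySplit) :
    Function.Injective y := by
  obtain ⟨σ, hσ⟩ := hy (LinearMap.range y) y.rangeRestrict (LinearMap.range y).subtype rfl
  rw [injective_iff_map_eq_zero]
  intro x hx
  have h0 : y.rangeRestrict x = 0 := Subtype.ext hx
  have := LinearMap.congr_fun hσ x
  rw [LinearMap.comp_apply, h0, map_zero] at this
  exact this.symm

theorem LinearMap.IsLocallySplit.isPureEpi_mkQ_range [IsNoetherianRing A] {L Y : Type u}
    [AddCommGroup L] [AddCommGroup Y] [Module A L] [Module A Y] [Module.Finite A L]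
    {y : L →ₗ[A] Y} (hy : y.IsLocallySplit) : (LinearMap.range y).mkQ.IsPureEpi := by
  refine Submodule.isPureEpi_mkQ_of_exists_correction _ fun k K g hK ↦ ?_
  let B := LinearMap.range g ⊔ LinearMap.range y
  have : Module.Finite A B := Module.Finite.iff_fg.2
    ((Module.Finite.iff_fg.1 inferInstance).sup (Module.Finite.iff_fg.1 inferInstance))
  let yB : L →ₗ[A] B := y.codRestrict B fun x ↦ Submodule.mem_sup_right ⟨x, rfl⟩
  let gB : (Fin k → A) →ₗ[A] B := g.codRestrict B fun x ↦ Submodule.mem_sup_left ⟨x, rfl⟩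
  obtain ⟨σ, hσ⟩ := hy B yB B.subtype rfl
  refine ⟨y ∘ₗ σ ∘ₗ gB, fun x ↦ ⟨_, rfl⟩, fun x hx ↦ ?_⟩
  obtain ⟨l, hl⟩ := hK hx
  have h1 : gB x = yB l := Subtype.ext hl.symm
  have h2 : σ (yB l) = l := LinearMap.congr_fun hσ l
  simp only [LinearMap.comp_apply, h1, h2]
  exact hl

theorem Submodule.isPureEpi_mkQ_comap {X : Type*} [AddCommGroup X] [Module A X]
    {p : Submodule A X} (hp : p.mkQ.IsPureEpi) {q : Submodule A (X ⧸ p)} (hq : q.mkQ.IsPureEpi) :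
    (q.comap p.mkQ).mkQ.IsPureEpi := by
  intro B _ _ _ f
  let θ : (X ⧸ q.comap p.mkQ) →ₗ[A] (X ⧸ p) ⧸ q := (q.comap p.mkQ).mapQ q p.mkQ le_rfl
  have hθ : Function.Injective θ := by
    rw [injective_iff_map_eq_zero]
    intro x hx
    obtain ⟨x, rfl⟩ := Submodule.mkQ_surjective _ x
    have : p.mkQ x ∈ q := (Submodule.Quotient.mk_eq_zero q).1 hx
    exact (Submodule.Quotient.mk_eq_zero _).2 this
  obtain ⟨g, hg⟩ := hq B (θ ∘ₗ f)
  obtain ⟨h, hh⟩ := hp B g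
  refine ⟨h, LinearMap.ext fun b ↦ hθ ?_⟩
  have h1 : q.mkQ (p.mkQ (h b)) = θ (f b) := by
    rw [← LinearMap.comp_apply p.mkQ, hh]
    exact LinearMap.congr_fun hg b
  exact h1

/-! ### Modules locally in the additive closure of a finitely generated module -/

/-- Every map from a finitely generated module to `X` factors through a finite power of `M`. -/
def Module.IsLocallyAdd (M X : Type u) [AddCommGroup M] [AddCommGroup X] [Module A M]
    [Module A X] : Prop :=
  ∀ (B : Type u) [AddCommGroup B] [Module A B] [Module.Finite A B] (f : B →ₗ[A] X),
    ∃ (k : ℕ) (g : B →ₗ[A] (Fin k → M)) (h : (Fin k → M) →ₗ[A] X), h ∘ₗ g = f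

theorem Module.IsLocallyAdd.of_isPureEpi {M X Y : Type u} [AddCommGroup M] [AddCommGroup X]
    [AddCommGroup Y] [Module A M] [Module A X] [Module A Y] (hX : Module.IsLocallyAdd (A := A) M X)
    {f : X →ₗ[A] Y} (hf : f.IsPureEpi) : Module.IsLocallyAdd (A := A) M Y := by
  intro B _ _ _ b
  obtain ⟨b', rfl⟩ := hf B b
  obtain ⟨k, g, h, rfl⟩ := hX B b'
  exact ⟨k, g, f ∘ₗ h, rfl⟩

/-- An endomorphism `g ∘ ρ` outside the Jacobson radical of `End M`, where `ρ : M → L` is a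
retraction onto an indecomposable module, has `g : L → M` a split monomorphism. -/
theorem Module.IsIndecomposable.exists_leftInverse_of_notMem_jacobson {M L : Type*}
    [AddCommGroup M] [AddCommGroup L] [Module A M] [Module A L] [IsNoetherian A L] [IsArtinian A L]
    (hL : Module.IsIndecomposable A L) (ρ : M →ₗ[A] L) (g : L →ₗ[A] M)
    (h : (g ∘ₗ ρ : Module.End A M) ∉ Ring.jacobson (Module.End A M)) :
    ∃ σ : M →ₗ[A] L, σ ∘ₗ g = LinearMap.id := by
  rw [← Ideal.jacobson_bot, Ideal.mem_jacobson_iff] at h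
  push Not at h
  obtain ⟨y, hy⟩ := h
  have hnu : ¬ IsUnit (1 + y * (g ∘ₗ ρ)) := by
    rintro ⟨u, hu⟩
    refine hy ↑u⁻¹ ?_
    have : (↑u⁻¹ : Module.End A M) * (1 + y * (g ∘ₗ ρ)) = 1 := by rw [← hu, Units.inv_mul]
    rw [mul_add, mul_one, ← mul_assoc] at this
    rw [Ideal.mem_bot, sub_eq_zero, add_comm, this]
  rcases hL.isUnit_or_isNilpotent (ρ ∘ₗ y ∘ₗ g : Module.End A L) with ⟨u, hu⟩ | ⟨k, hk⟩
  · refine ⟨(↑u⁻¹ : Module.End A L) ∘ₗ ρ ∘ₗ y, ?_⟩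
    have : (↑u⁻¹ : Module.End A L) * ↑u = 1 := Units.inv_mul u
    rw [hu] at this
    exact this
  · refine (hnu ?_).elim
    have hpow : ∀ k : ℕ, (y * (g ∘ₗ ρ) : Module.End A M) ^ (k + 1) =
        y ∘ₗ g ∘ₗ ((ρ ∘ₗ y ∘ₗ g : Module.End A L) ^ k) ∘ₗ ρ := by
      intro k
      induction k with
      | zero => rw [zero_add, pow_one, pow_zero]; rfl
      | succ k ih => rw [pow_succ, ih, pow_succ]; rfl
    have hnil : IsNilpotent (y * (g ∘ₗ ρ) : Module.End A M) :=
      ⟨k + 1, by rw [hpow, hk]; ext x; simp⟩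
    exact hnil.isUnit_one_add

/-- A nonzero module `Y` which is locally in `add M` admits a locally split map from an
indecomposable summand of `M`, if the radical `J` of `End M` is nilpotent. Indeed the `End M`-module
`Hom(M, Y)` is not equal to its radical `Hom(M, Y) J`, and any map `x` outside it can be restricted
to a suitable indecomposable summand. -/
theorem Module.IsLocallyAdd.exists_isLocallySplit {M Y : Type u} [AddCommGroup M]
    [AddCommGroup Y] [Module A M] [Module A Y] [IsNoetherian A M] [IsArtinian A M]
    (hJ : IsNilpotent (Ring.jacobson (Module.End A M)))
    (hY : Module.IsLocallyAdd (A := A) M Y) [Nontrivial Y] :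
    ∃ (L : Type u) (_ : AddCommGroup L) (_ : Module A L) (i : L →ₗ[A] M) (r : M →ₗ[A] L)
      (y : L →ₗ[A] Y), r ∘ₗ i = LinearMap.id ∧ Nontrivial L ∧ Module.Finite A L ∧
      y.IsLocallySplit := by
  let FJ (I : Ideal (Module.End A M)) : AddSubgroup (M →ₗ[A] Y) :=
    AddSubgroup.closure {z | ∃ (x : M →ₗ[A] Y) (g : Module.End A M), g ∈ I ∧ z = x ∘ₗ g}
  obtain ⟨x, hx⟩ : ∃ x, x ∉ FJ (Ring.jacobson (Module.End A M)) := by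
    by_contra! hall
    have hpow : ∀ (k : ℕ) (x : M →ₗ[A] Y), x ∈ FJ (Ring.jacobson (Module.End A M) ^ k) := by
      intro k
      induction k with
      | zero =>
        exact fun x ↦ AddSubgroup.subset_closure ⟨x, 1, by
          rw [Submodule.pow_zero, Ideal.one_eq_top]; exact Submodule.mem_top, rfl⟩
      | succ k ih =>
        intro x
        refine (AddSubgroup.closure_le _).2 ?_ (ih x)
        rintro _ ⟨x, g, hg, rfl⟩
        have hx := hall x
        refine AddSubgroup.closure_induction
          (p := fun x _ ↦ x ∘ₗ g ∈ FJ (Ring.jacobson (Module.End A M) ^ (k + 1))) ?_ ?_ ?_ ?_ hx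
        · rintro _ ⟨x', g', hg', rfl⟩
          refine AddSubgroup.subset_closure ⟨x', g' * g, ?_, rfl⟩
          rw [Ideal.IsTwoSided.pow_succ]
          exact Ideal.mul_mem_mul hg' hg
        · rw [LinearMap.zero_comp]; exact zero_mem _
        · intro a b _ _ ha hb
          rw [LinearMap.add_comp]; exact add_mem ha hb
        · intro a _ ha
          rw [LinearMap.neg_comp]; exact neg_mem ha
    obtain ⟨k, hk⟩ := hJ
    have hzero : ∀ x : M →ₗ[A] Y, x = 0 := by
      intro x
      have hle : FJ (Ring.jacobson (Module.End A M) ^ k) ≤ ⊥ := by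
        rw [hk]
        refine (AddSubgroup.closure_le _).2 ?_
        rintro _ ⟨x, g, hg, rfl⟩
        have : g = 0 := hg
        simp [this]
      exact AddSubgroup.mem_bot.1 (hle (hpow k x))
    obtain ⟨y, hy⟩ := exists_ne (0 : Y)
    obtain ⟨k, g, h, hgh⟩ := hY A (LinearMap.toSpanSingleton A Y y)
    have h0 : h = 0 := LinearMap.pi_ext' fun s ↦ by rw [hzero (h ∘ₗ _), LinearMap.zero_comp]
    apply hy
    have := LinearMap.congr_fun hgh 1
    simpa [h0] using this.symm
  have hdec : ∃ (L : Type u) (_ : AddCommGroup L) (_ : Module A L) (i : L →ₗ[A] M)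
      (r : M →ₗ[A] L), r ∘ₗ i = LinearMap.id ∧ Module.Finite A L ∧ Module.IsIndecomposable A L ∧
      x ∘ₗ i ∘ₗ r ∉ FJ (Ring.jacobson (Module.End A M)) := by
    refine Module.induction_on_indecomposable (A := A)
      (P := fun L _ _ ↦ ∀ (i : L →ₗ[A] M) (r : M →ₗ[A] L), r ∘ₗ i = LinearMap.id →
        x ∘ₗ i ∘ₗ r ∉ FJ (Ring.jacobson (Module.End A M)) →
        ∃ (L : Type u) (_ : AddCommGroup L) (_ : Module A L) (i : L →ₗ[A] M)
        (r : M →ₗ[A] L), r ∘ₗ i = LinearMap.id ∧ Module.Finite A L ∧ Module.IsIndecomposable A L ∧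
        x ∘ₗ i ∘ₗ r ∉ FJ (Ring.jacobson (Module.End A M))) ?_ ?_ ?_ M LinearMap.id LinearMap.id rfl
        hx
    · intro L _ _ hL i r _ h
      refine (h ?_).elim
      have : x ∘ₗ i ∘ₗ r = 0 := by
        ext m; simp [Subsingleton.elim (r m) 0]
      rw [this]; exact zero_mem _
    · exact fun L _ _ hf hL i r hri h ↦ ⟨L, _, _, i, r, hri, hf, hL, h⟩
    · intro L _ _ p q hpq hp hq i r hri h
      have hri' : ∀ l, r (i l) = l := LinearMap.congr_fun hri
      by_cases h1 : x ∘ₗ (i ∘ₗ p.subtype) ∘ₗ (p.projectionOnto q hpq ∘ₗ r) ∈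
          FJ (Ring.jacobson (Module.End A M))
      · refine hq (i ∘ₗ q.subtype) (q.projectionOnto p hpq.symm ∘ₗ r) ?_ fun h2 ↦ h ?_
        · ext l; simp [hri', Submodule.projectionOnto_apply_left]
        · convert add_mem h1 h2 using 1
          ext m
          have : (p.projectionOnto q hpq (r m) : L) + q.projectionOnto p hpq.symm (r m) = r m := by
            obtain ⟨a, ha, b, hb, hab⟩ := Submodule.mem_sup.1
              (hpq.sup_eq_top ▸ Submodule.mem_top : r m ∈ p ⊔ q)
            rw [← hab, map_add, map_add, Submodule.projectionOnto_apply_of_mem_left hpq ha,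
              Submodule.projectionOnto_apply_of_mem_left hpq.symm hb,
              (Submodule.projectionOnto_apply_eq_zero_iff hpq).2 hb,
              (Submodule.projectionOnto_apply_eq_zero_iff hpq.symm).2 ha, add_zero, zero_add]
          simp only [LinearMap.comp_apply, LinearMap.add_apply, Submodule.subtype_apply,
            ← map_add, this]
      · exact hp (i ∘ₗ p.subtype) (p.projectionOnto q hpq ∘ₗ r)
          (by ext l; simp [hri', Submodule.projectionOnto_apply_left]) h1
  obtain ⟨L, _, _, i, r, hri, hf, hL, hxL⟩ := hdec
  refine ⟨L, _, _, i, r, x ∘ₗ i, hri, hL.1, hf, ?_⟩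
  intro B _ _ _ g h hgh
  have : IsNoetherian A L := isNoetherian_of_injective i
    (Function.LeftInverse.injective (LinearMap.congr_fun hri))
  have : IsArtinian A L := isArtinian_of_injective i
    (Function.LeftInverse.injective (LinearMap.congr_fun hri))
  obtain ⟨k, h₁, h₂, rfl⟩ := hY B h
  classical
  have hsum : x ∘ₗ i ∘ₗ r = ∑ s : Fin k, (h₂ ∘ₗ LinearMap.single A (fun _ ↦ M) s) ∘ₗ
      ((LinearMap.proj s ∘ₗ h₁ ∘ₗ g) ∘ₗ r) := by
    rw [← LinearMap.comp_assoc, ← hgh]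
    ext m
    simp only [LinearMap.comp_apply, LinearMap.sum_apply, ← map_sum]
    congr 1
    exact (LinearMap.sum_single_apply (fun _ ↦ M) (h₁ (g (r m)))).symm
  obtain ⟨s, hs⟩ : ∃ s : Fin k, ((LinearMap.proj s ∘ₗ h₁ ∘ₗ g) ∘ₗ r : Module.End A M) ∉
      Ring.jacobson (Module.End A M) := by
    by_contra! hall
    apply hxL
    rw [hsum]
    exact sum_mem fun s _ ↦ AddSubgroup.subset_closure ⟨_, _, hall s, rfl⟩
  obtain ⟨σ, hσ⟩ := hL.exists_leftInverse_of_notMem_jacobson r _ hs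
  exact ⟨σ ∘ₗ LinearMap.proj s ∘ₗ h₁, hσ⟩

/-- A module which is locally in `add M` is a direct sum of summands of `M`, if `M` has finite
length and the radical of `End M` is nilpotent: a maximal independent set of submodules which are
summands of `M` and have pure sum must have sum `X`. -/
theorem Module.IsLocallyAdd.exists_isInternal [IsNoetherianRing A] {M X : Type u}
    [AddCommGroup M] [AddCommGroup X] [Module A M] [Module A X] [IsNoetherian A M] [IsArtinian A M]
    (hJ : IsNilpotent (Ring.jacobson (Module.End A M)))
    (hX : Module.IsLocallyAdd (A := A) M X) :
    ∃ S : Set (Submodule A X), (∀ L ∈ S, ∃ (i : L →ₗ[A] M) (r : M →ₗ[A] L),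
      r ∘ₗ i = LinearMap.id) ∧ iSupIndep (fun L : S ↦ (L : Submodule A X)) ∧
      ⨆ L : S, (L : Submodule A X) = ⊤ := by
  let 𝒮 : Set (Set (Submodule A X)) := {S | (∀ L ∈ S, ∃ (i : L →ₗ[A] M) (r : M →ₗ[A] L),
      r ∘ₗ i = LinearMap.id) ∧ sSupIndep S ∧ (sSup S).mkQ.IsPureEpi}
  have hempty : (∅ : Set (Submodule A X)) ∈ 𝒮 := by
    refine ⟨by simp, sSupIndep_empty, ?_⟩
    rw [sSup_empty]
    exact fun B _ _ _ g ↦ ⟨(Submodule.quotEquivOfEqBot ⊥ rfl).toLinearMap ∘ₗ g, by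
      ext b; exact (Submodule.quotEquivOfEqBot (⊥ : Submodule A X) rfl).symm_apply_apply _⟩
  obtain ⟨S, -, hS⟩ := zorn_subset_nonempty 𝒮 (fun c hc hchain hne ↦ by
    refine ⟨⋃₀ c, ⟨fun L ⟨S, hS, hL⟩ ↦ (hc hS).1 L hL,
      iSupIndep_sUnion_of_directed hchain.directedOn fun S hS ↦ (hc hS).2.1, ?_⟩,
      fun S hS ↦ Set.subset_sUnion_of_mem hS⟩
    rw [sSup_sUnion, ← sSup_image]
    refine Submodule.isPureEpi_mkQ_sSup (hne.image _) ?_ (by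
      rintro _ ⟨S, hS, rfl⟩; exact (hc hS).2.2)
    rintro _ ⟨S, hS, rfl⟩ _ ⟨T, hT, rfl⟩
    obtain ⟨U, hU, hSU, hTU⟩ := hchain.directedOn S hS T hT
    exact ⟨_, ⟨U, hU, rfl⟩, sSup_le_sSup hSU, sSup_le_sSup hTU⟩) ∅ hempty
  refine ⟨S, hS.1.1, (sSupIndep_iff S).1 hS.1.2.1, ?_⟩
  rw [← sSup_eq_iSup']
  by_contra htop
  have : Nontrivial (X ⧸ sSup S) := Submodule.Quotient.nontrivial_iff.2 htop
  obtain ⟨L, _, _, i, r, y, hri, hL, hfin, hy⟩ :=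
    (hX.of_isPureEpi hS.1.2.2).exists_isLocallySplit hJ
  obtain ⟨z, rfl⟩ := hS.1.2.2 L y
  have hinj := hy.injective
  have hz : Function.Injective z := fun a b hab ↦ hinj (by simp [hab])
  have hdisj : Disjoint (LinearMap.range z) (sSup S) := by
    rw [Submodule.disjoint_def]
    rintro _ ⟨l, rfl⟩ hl
    have : ((sSup S).mkQ ∘ₗ z) l = ((sSup S).mkQ ∘ₗ z) 0 := by
      rw [map_zero]; exact (Submodule.Quotient.mk_eq_zero _).2 hl
    rw [hinj this, map_zero]
  have hins : insert (LinearMap.range z) S ∈ 𝒮 := by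
    refine ⟨?_, ?_, ?_⟩
    · rintro N (rfl | hN)
      · let e := LinearEquiv.ofInjective z hz
        refine ⟨i ∘ₗ e.symm.toLinearMap, e.toLinearMap ∘ₗ r, ?_⟩
        refine LinearMap.ext fun n ↦ ?_
        have := LinearMap.congr_fun hri (e.symm n)
        simp only [LinearMap.comp_apply] at this
        simp [this]
      · exact hS.1.1 N hN
    · rintro N (rfl | hN)
      · exact hdisj.mono_right (sSup_le_sSup fun K hK ↦
          (Set.mem_insert_iff.1 hK.1).resolve_left hK.2)
      · have hle : sSup (insert (LinearMap.range z) S \ {N}) ≤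
            sSup (S \ {N}) ⊔ LinearMap.range z := by
          refine sSup_le ?_
          rintro K ⟨rfl | hK, hKN⟩
          · exact le_sup_right
          · exact (le_sSup (show K ∈ S \ {N} from ⟨hK, hKN⟩)).trans le_sup_left
        refine Disjoint.mono_right hle
          ((hS.1.2.1 hN).disjoint_sup_right_of_disjoint_sup_left
            (hdisj.mono_right (sup_le (le_sSup hN) (sSup_le_sSup Set.sdiff_subset))).symm)
    · have : sSup (insert (LinearMap.range z) S) =
          (LinearMap.range ((sSup S).mkQ ∘ₗ z)).comap (sSup S).mkQ := by
        rw [sSup_insert, LinearMap.range_comp, Submodule.comap_map_eq, Submodule.ker_mkQ]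
      rw [this]
      exact Submodule.isPureEpi_mkQ_comap hS.1.2.2 hy.isPureEpi_mkQ_range
  have hmem : LinearMap.range z ∈ S := hS.2 hins (Set.subset_insert _ _) (Set.mem_insert _ _)
  have hbot := hdisj.eq_bot_of_le (le_sSup hmem)
  obtain ⟨l, hl⟩ := exists_ne (0 : L)
  rw [LinearMap.range_eq_bot] at hbot
  exact hl (hz (by simp [hbot]))

end Purity

/-! ### Modules locally in a class of finitely generated modules -/

namespace ModuleCat

variable {A : Type u} [Ring A]

/-- The modules `X` such that every map from a finitely generated module to `X` factors through a
module satisfying `P`. -/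
def isLocally (P : ObjectProperty (ModuleCat.{u} A)) : ObjectProperty (ModuleCat.{u} A) :=
  fun X ↦ ∀ (B : ModuleCat.{u} A), Module.Finite A B → ∀ f : B ⟶ X,
    ∃ (N : ModuleCat.{u} A) (g : B ⟶ N) (h : N ⟶ X), P N ∧ g ≫ h = f

theorem exists_fg_projective_cover [IsNoetherianRing A] (B : ModuleCat.{u} A)
    (hB : Module.Finite A B) : ∃ (F : ModuleCat.{u} A) (p : F ⟶ B), Epi p ∧ Projective F ∧
      Module.Finite A F ∧ Module.Finite A (kernel p : ModuleCat.{u} A) := by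
  obtain ⟨k, π, hπ⟩ := Module.Finite.exists_fin' A B
  refine ⟨ModuleCat.of A (Fin k → A), ModuleCat.ofHom π, (ModuleCat.epi_iff_surjective _).2 hπ,
    (IsProjective.iff_projective (R := A) (Fin k → A)).1 inferInstance, inferInstance, ?_⟩
  exact Module.Finite.of_injective (kernel.ι (ModuleCat.ofHom π)).hom
    ((ModuleCat.mono_iff_injective _).1 inferInstance)

/-- If `X` is locally in `P`, then the vanishing of `Ext^i(B, -)` on `P` implies its vanishing
on `X`, for `B` finitely generated and `i ≥ 1`. -/
theorem ext_subsingleton_of_isLocally [IsNoetherianRing A] {P : ObjectProperty (ModuleCat.{u} A)}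
    {X : ModuleCat.{u} A} (hX : isLocally P X) (i : ℕ) (B : ModuleCat.{u} A)
    (hB : Module.Finite A B) (h : ∀ N, P N → Subsingleton (Ext.{u} B N (i + 1))) :
    Subsingleton (Ext.{u} B X (i + 1)) := by
  induction i generalizing B with
  | zero =>
    obtain ⟨F, p, hp, hF, -, hK⟩ := exists_fg_projective_cover B hB
    let S := ShortComplex.mk _ _ (kernel.condition p)
    have hS : S.ShortExact := { exact := ShortComplex.exact_kernel p }
    refine Ext.subsingleton_X₃_one_left hS X (Ext.subsingleton_of_projective F X 0) fun f ↦ ?_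
    obtain ⟨N, g, h', hN, rfl⟩ := hX _ hK f
    obtain ⟨g', rfl⟩ := Ext.exists_extension hS (h N hN) g
    exact ⟨g' ≫ h', (Category.assoc _ _ _).symm⟩
  | succ i ih =>
    obtain ⟨F, p, hp, hF, -, hK⟩ := exists_fg_projective_cover B hB
    let S := ShortComplex.mk _ _ (kernel.condition p)
    have hS : S.ShortExact := { exact := ShortComplex.exact_kernel p }
    exact Ext.subsingleton_X₃_left hS X _
      (ih _ hK fun N hN ↦ Ext.subsingleton_X₁_left hS N _
        (Ext.subsingleton_of_projective F N i) (h N hN))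
      (Ext.subsingleton_of_projective F X _)

theorem isLocally_of_isPureEpi {P : ObjectProperty (ModuleCat.{u} A)} {X Y : ModuleCat.{u} A}
    (f : X ⟶ Y) (hf : f.hom.IsPureEpi) (hX : isLocally P X) : isLocally P Y := by
  intro B hB b
  obtain ⟨b', hb'⟩ := hf B b.hom
  obtain ⟨N, g, h, hN, hgh⟩ := hX B hB (ModuleCat.ofHom b')
  refine ⟨N, g, h ≫ f, hN, ?_⟩
  rw [← Category.assoc, hgh]
  exact ModuleCat.hom_ext hb'

theorem le_addClosure (P : ObjectProperty (ModuleCat.{u} A)) :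
    P ≤ ObjectProperty.addClosure.{u} P := fun X hX ↦
  ⟨PUnit, fun _ ↦ X, fun _ ↦ hX,
    ⟨{ i := Limits.Sigma.ι (fun _ : PUnit.{u + 1} ↦ X) PUnit.unit
       r := Limits.Sigma.desc fun _ ↦ 𝟙 X }⟩⟩

/-- A map onto a summand of a direct sum of finitely generated modules splits as soon as maps from
finitely generated modules lift along it. -/
theorem exists_section_of_isPureEpi {P : ObjectProperty (ModuleCat.{u} A)}
    (hP : ∀ X, P X → Module.Finite A X) {X Y : ModuleCat.{u} A} (f : X ⟶ Y)
    (hf : f.hom.IsPureEpi) (hY : ObjectProperty.addClosure.{u} P Y) : ∃ s : Y ⟶ X, s ≫ f = 𝟙 Y := by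
  obtain ⟨ι, F, hF, ⟨r⟩⟩ := hY
  have hlift : ∀ j, ∃ g : F j ⟶ X, g ≫ f = Limits.Sigma.ι F j ≫ r.r := fun j ↦ by
    have := hP _ (hF j)
    obtain ⟨g, hg⟩ := hf (F j) (Limits.Sigma.ι F j ≫ r.r).hom
    exact ⟨ModuleCat.ofHom g, ModuleCat.hom_ext hg⟩
  choose g hg using hlift
  refine ⟨r.i ≫ Limits.Sigma.desc g, ?_⟩
  have : Limits.Sigma.desc g ≫ f = r.r := by ext1 j; simp [hg]
  rw [Category.assoc, this, r.retract]

theorem ext_addClosure_subsingleton {P : ObjectProperty (ModuleCat.{u} A)} {X N : ModuleCat.{u} A}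
    {i : ℕ} (hi : 1 ≤ i) (h : ∀ N, P N → Subsingleton (Ext.{u} N X i))
    (hN : ObjectProperty.addClosure.{u} P N) : Subsingleton (Ext.{u} N X i) := by
  obtain ⟨ι, F, hF, ⟨r⟩⟩ := hN
  obtain ⟨i, rfl⟩ := Nat.exists_eq_add_of_le' hi
  exact Ext.subsingleton_of_retract_left r
    (Ext.subsingleton_sigma F i X fun j ↦ h (F j) (hF j))

end ModuleCat

/-- The families of finite support form a submodule of the product; the projection to the quotient
is pure, since the supports of finitely many elements have finite union. -/
theorem Submodule.exists_finite_support_isPureEpi {A : Type u} [Ring A] [IsNoetherianRing A]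
    {ι : Type*} (N : ι → Type*) [∀ i, AddCommGroup (N i)] [∀ i, Module A (N i)] :
    ∃ D : Submodule A (∀ i, N i), (∀ x, x ∈ D ↔ {i | x i ≠ 0}.Finite) ∧ D.mkQ.IsPureEpi := by
  classical
  let D : Submodule A (∀ i, N i) :=
    { carrier := {x | {i | x i ≠ 0}.Finite}
      add_mem' := fun {x y} hx hy ↦ (hx.union hy).subset fun i hi ↦ by
        by_contra h
        simp only [Set.mem_union, Set.mem_ofPred_eq, not_or, not_not] at h
        exact hi (by simp [h.1, h.2])
      zero_mem' := by simp
      smul_mem' := fun a x hx ↦ hx.subset fun i hi h ↦ hi (by simp [h]) }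
  refine ⟨D, fun x ↦ Iff.rfl, Submodule.isPureEpi_mkQ_of_exists_correction _ fun k K g hK ↦ ?_⟩
  obtain ⟨t, ht⟩ := IsNoetherian.noetherian K
  let T : Set ι := ⋃ x ∈ t, {i | g x i ≠ 0}
  have hT : T.Finite := Set.Finite.biUnion t.finite_toSet fun x hx ↦
    hK (ht ▸ Submodule.subset_span hx)
  let e : (∀ i, N i) →ₗ[A] (∀ i, N i) :=
    LinearMap.pi fun i ↦ if i ∈ T then LinearMap.proj i else 0
  have he : ∀ x i, e x i = if i ∈ T then x i else 0 := fun x i ↦ by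
    by_cases h : i ∈ T <;> simp [e, h]
  refine ⟨e ∘ₗ g, fun x ↦ hT.subset fun i hi ↦ ?_, fun x hx ↦ ?_⟩
  · by_contra h
    exact hi (by rw [LinearMap.comp_apply, he, if_neg h])
  · have hle : K ≤ LinearMap.eqLocus (e ∘ₗ g) g := by
      rw [← ht, Submodule.span_le]
      intro y hy
      refine funext fun i ↦ ?_
      rw [LinearMap.comp_apply, he]
      split_ifs with h
      · rfl
      · by_contra h0
        exact h (Set.mem_biUnion hy (Ne.symm h0))
    exact hle hx

/-- The endomorphism ring of a finitely generated module over an artin algebra has nilpotent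
radical. -/
theorem Module.isNilpotent_jacobson_end (R : Type v) {A : Type u} [CommRing R]
    [IsArtinianRing R] [Ring A] [Algebra R A] [Module.Finite R A] (M : Type*) [AddCommGroup M]
    [Module A M] [Module.Finite A M] : IsNilpotent (Ring.jacobson (Module.End A M)) := by
  let : Module R M := Module.compHom M (algebraMap R A)
  have : IsScalarTower R A M := ⟨fun a b x ↦ by rw [Algebra.smul_def, mul_smul]; rfl⟩
  have : Module.Finite R M := Module.Finite.trans A M
  let ρ : Module.End A M →ₗ[R] Module.End R M := LinearMap.restrictScalarsₗ R A M M R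
  have hρ : Function.Injective ρ := LinearMap.restrictScalars_injective R
  have : Module.Finite R (Module.End A M) := Module.Finite.of_injective ρ hρ
  have : IsArtinianRing (Module.End A M) := isArtinian_of_tower R inferInstance
  exact IsSemiprimaryRing.isNilpotent

/-! ### Cluster tilting classes of finitely generated modules -/

namespace ModuleCat

variable {A : Type u} [Ring A]

/-- The properties of an `n`-cluster tilting subcategory `P` of the finitely generated modules,
expressed with the groups `Ext` in the category of all modules. -/
structure IsFGClusterTilting (n : ℕ) (P : ObjectProperty (ModuleCat.{u} A)) : Prop where
  finite (X : ModuleCat.{u} A) : P X → Module.Finite A X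
  rigid (i : ℕ) : 1 ≤ i → i < n → ∀ M N : ModuleCat.{u} A, P M → P N →
    Subsingleton (Ext.{u} M N i)
  of_ext_left (X : ModuleCat.{u} A) : Module.Finite A X → (∀ i : ℕ, 1 ≤ i → i < n →
    ∀ M : ModuleCat.{u} A, P M → Subsingleton (Ext.{u} X M i)) → P X
  of_ext_right (X : ModuleCat.{u} A) : Module.Finite A X → (∀ i : ℕ, 1 ≤ i → i < n →
    ∀ M : ModuleCat.{u} A, P M → Subsingleton (Ext.{u} M X i)) → P X
  exists_approx (X : ModuleCat.{u} A) : Module.Finite A X →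
    ∃ (N : ModuleCat.{u} A) (f : X ⟶ N), P N ∧ Mono f ∧
      ∀ N' : ModuleCat.{u} A, P N' → ∀ g : X ⟶ N', ∃ h : N ⟶ N', f ≫ h = g

namespace IsFGClusterTilting

variable {n : ℕ} {P : ObjectProperty (ModuleCat.{u} A)} (hP : IsFGClusterTilting n P)
include hP

theorem of_retract {X Y : ModuleCat.{u} A} (r : Retract X Y) (hY : P Y) : P X := by
  have := hP.finite Y hY
  refine hP.of_ext_right X (Module.Finite.of_surjective r.r.hom ?_) fun i h₁ h₂ M hM ↦
    Ext.subsingleton_of_retract_right r (hP.rigid i h₁ h₂ M Y hM hY)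
  exact fun x ↦ ⟨r.i.hom x, LinearMap.congr_fun (congrArg ModuleCat.Hom.hom r.retract) x⟩

theorem of_linearRetract {X Y : Type u} [AddCommGroup X] [AddCommGroup Y] [Module A X] [Module A Y]
    (i : X →ₗ[A] Y) (r : Y →ₗ[A] X) (h : r ∘ₗ i = LinearMap.id) (hY : P (ModuleCat.of A Y)) :
    P (ModuleCat.of A X) :=
  hP.of_retract { i := ModuleCat.ofHom i, r := ModuleCat.ofHom r, retract := ModuleCat.hom_ext h }
    hY

theorem pi {k : ℕ} (N : Fin k → ModuleCat.{u} A) (hN : ∀ s, P (N s)) :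
    P (ModuleCat.of A (∀ s, N s)) := by
  have := fun s ↦ hP.finite _ (hN s)
  refine hP.of_ext_right _ (inferInstanceAs (Module.Finite A (∀ s, N s))) fun i h₁ h₂ M hM ↦ ?_
  obtain ⟨i, rfl⟩ := Nat.exists_eq_add_of_le' h₁
  exact Ext.subsingleton_of_retract_right (Retract.ofIso (ModuleCat.piIsoPi N).symm)
    (Ext.subsingleton_pi N i M fun s ↦ hP.rigid _ h₁ h₂ M _ hM (hN s))

theorem of_projective (X : ModuleCat.{u} A) [Module.Finite A X] [Projective X] : P X :=
  hP.of_ext_left X inferInstance fun i h₁ _ M _ ↦ by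
    obtain ⟨i, rfl⟩ := Nat.exists_eq_add_of_le' h₁
    exact Ext.subsingleton_of_projective X M i

/-- If `Ext^i(P, X) = 0` for `1 ≤ i < n` and `Ext^i(C, P) = 0` for `1 ≤ i ≤ j`, where `C` is
finitely generated, then `Ext^j(C, X) = 0`: descending induction on `j`, passing from `C` to the
cokernel of a left approximation. -/
theorem ext_subsingleton {X : ModuleCat.{u} A}
    (hX : ∀ i : ℕ, 1 ≤ i → i < n → ∀ M, P M → Subsingleton (Ext.{u} M X i))
    (k j : ℕ) (hj : 1 ≤ j) (hk : j + k + 1 = n) (C : ModuleCat.{u} A) (hC : Module.Finite A C)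
    (h : ∀ i : ℕ, 1 ≤ i → i ≤ j → ∀ M, P M → Subsingleton (Ext.{u} C M i)) :
    Subsingleton (Ext.{u} C X j) := by
  induction k generalizing j C with
  | zero => exact hX j hj (by lia) C (hP.of_ext_left C hC fun i h₁ h₂ ↦ h i h₁ (by lia))
  | succ k ih =>
    obtain ⟨N, f, hN, hf, hfac⟩ := hP.exists_approx C hC
    have hNf := hP.finite N hN
    have hcok : Module.Finite A (cokernel f : ModuleCat.{u} A) :=
      Module.Finite.of_surjective (cokernel.π f).hom
        ((ModuleCat.epi_iff_surjective _).1 inferInstance)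
    let S := ShortComplex.mk _ _ (cokernel.condition f)
    have hS : S.ShortExact := { exact := ShortComplex.exact_cokernel f }
    refine Ext.subsingleton_X₁_left hS X j (hX j hj (by lia) N hN)
      (ih (j + 1) (by lia) (by lia) (cokernel f) hcok fun i h₁ h₂ M hM ↦ ?_)
    obtain ⟨i, rfl⟩ := Nat.exists_eq_add_of_le' h₁
    obtain rfl | hi := Nat.eq_zero_or_pos i
    · exact Ext.subsingleton_X₃_one_left hS M (hP.rigid _ le_rfl (by lia) N M hN hM)
        fun g ↦ hfac M hM g
    · exact Ext.subsingleton_X₃_left hS M i (h i hi (by lia) M hM)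
        (hP.rigid _ (by lia) (by lia) N M hN hM)

/-- A module `X` with `Ext^i(P, X) = 0` for `1 ≤ i < n` is locally in `P`: the first extension group
of the cokernel of a left approximation `B → N` with `X` vanishes, so every map `B → X` extends
to `N`. -/
theorem isLocally_of_ext {X : ModuleCat.{u} A}
    (hX : ∀ i : ℕ, 1 ≤ i → i < n → ∀ M, P M → Subsingleton (Ext.{u} M X i)) :
    isLocally P X := by
  intro B hB b
  obtain hn | hn := le_or_gt n 1
  · exact ⟨B, 𝟙 B, b, hP.of_ext_left B hB fun i h₁ h₂ ↦ by lia, Category.id_comp b⟩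
  obtain ⟨N, f, hN, hf, hfac⟩ := hP.exists_approx B hB
  have hNf := hP.finite N hN
  have hcok : Module.Finite A (cokernel f : ModuleCat.{u} A) :=
    Module.Finite.of_surjective (cokernel.π f).hom
      ((ModuleCat.epi_iff_surjective _).1 inferInstance)
  let S := ShortComplex.mk _ _ (cokernel.condition f)
  have hS : S.ShortExact := { exact := ShortComplex.exact_cokernel f }
  have h1 : Subsingleton (Ext.{u} (cokernel f) X 1) := by
    refine hP.ext_subsingleton hX (n - 2) 1 le_rfl (by lia) _ hcok fun i h₁ h₂ M hM ↦ ?_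
    obtain rfl : i = 1 := by lia
    exact Ext.subsingleton_X₃_one_left hS M (hP.rigid _ le_rfl (by lia) N M hN hM)
      fun g ↦ hfac M hM g
  obtain ⟨g, hg⟩ := Ext.exists_extension hS h1 b
  exact ⟨N, f, g, hN, hg⟩

theorem isLocally_iff_ext [IsNoetherianRing A] {X : ModuleCat.{u} A} : isLocally P X ↔
    ∀ i : ℕ, 1 ≤ i → i < n → ∀ M, P M → Subsingleton (Ext.{u} M X i) := by
  refine ⟨fun hX i h₁ h₂ M hM ↦ ?_, hP.isLocally_of_ext⟩
  obtain ⟨i, rfl⟩ := Nat.exists_eq_add_of_le' h₁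
  exact ext_subsingleton_of_isLocally hX i M (hP.finite M hM) fun N hN ↦
    hP.rigid _ h₁ h₂ M N hM hN

/-- Products of modules in `P` are locally in `P`, because left approximations exist. -/
theorem isLocally_pi {ι : Type u} (N : ι → ModuleCat.{u} A) (hN : ∀ i, P (N i)) :
    isLocally P (ModuleCat.of A (∀ i, N i)) := by
  intro B hB b
  obtain ⟨N₀, f, hN₀, -, hfac⟩ := hP.exists_approx B hB
  choose h hh using fun i ↦ hfac (N i) (hN i) (ModuleCat.ofHom (LinearMap.proj i ∘ₗ b.hom))
  refine ⟨N₀, f, ModuleCat.ofHom (LinearMap.pi fun i ↦ (h i).hom), hN₀, ?_⟩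
  ext x i
  exact LinearMap.congr_fun (congrArg ModuleCat.Hom.hom (hh i)) x

/-- If the modules locally in `P` are summands of direct sums of modules in `P`, then the module of
families of finite support is a direct summand of the product. -/
theorem exists_finite_support_section [IsNoetherianRing A]
    (hloc : isLocally P ≤ ObjectProperty.addClosure.{u} P)
    {ι : Type u} (N : ι → ModuleCat.{u} A) (hN : ∀ i, P (N i)) :
    ∃ D : Submodule A (∀ i, N i), (∀ x, x ∈ D ↔ {i | x i ≠ 0}.Finite) ∧
      ObjectProperty.addClosure.{u} P (ModuleCat.of A ((∀ i, N i) ⧸ D)) ∧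
      ∃ s : ((∀ i, N i) ⧸ D) →ₗ[A] (∀ i, N i), D.mkQ ∘ₗ s = LinearMap.id := by
  obtain ⟨D, hD, hpure⟩ := Submodule.exists_finite_support_isPureEpi (A := A) fun i ↦ N i
  have hq : ObjectProperty.addClosure.{u} P (ModuleCat.of A ((∀ i, N i) ⧸ D)) :=
    hloc _ (isLocally_of_isPureEpi (ModuleCat.ofHom D.mkQ) hpure (hP.isLocally_pi N hN))
  obtain ⟨s, hs⟩ := exists_section_of_isPureEpi hP.finite (ModuleCat.ofHom D.mkQ) hpure hq
  exact ⟨D, hD, hq, s.hom, congrArg ModuleCat.Hom.hom hs⟩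

end IsFGClusterTilting

end ModuleCat

/-! ### From the cluster tilting property to an additive generator -/

namespace ModuleCat.IsFGClusterTilting

variable {A : Type u} [Ring A] {n : ℕ} {P : ObjectProperty (ModuleCat.{u} A)}

/-- If the modules locally in `P` are summands of direct sums of modules in `P`, then `P` has only
finitely many indecomposables up to isomorphism. Otherwise let `C` be the quotient of the
product of infinitely many pairwise nonisomorphic ones by the families of finite support.
It is a summand of the product and has an indecomposable finitely generated summand `L`. The
split monomorphism from `L` to the product forces `L` to be isomorphic to one of the factors; but as
the retraction vanishes on families of finite support, that factor may be left out, and `L` is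
isomorphic to another factor as well. -/
theorem exists_finset_indecomposable (R : Type v) [CommRing R] [IsArtinianRing R] [Algebra R A]
    [Module.Finite R A] [IsNoetherianRing A] (hP : IsFGClusterTilting n P)
    (hloc : isLocally P ≤ ObjectProperty.addClosure.{u} P) :
    ∃ s : Finset (ModuleCat.{u} A), (∀ N ∈ s, P N ∧ Module.IsIndecomposable A N) ∧
      ∀ L : ModuleCat.{u} A, P L → Module.IsIndecomposable A L →
        ∃ N ∈ s, Nonempty (L ≃ₗ[A] N) := by
  classical
  have : IsArtinianRing A := isArtinian_of_tower R inferInstance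
  by_contra! hcon
  have : Std.Symm (fun X Y : ModuleCat.{u} A ↦ ¬ Nonempty (X ≃ₗ[A] Y)) :=
    ⟨fun X Y h ⟨e⟩ ↦ h ⟨e.symm⟩⟩
  obtain ⟨N', hN', hpair⟩ := exists_seq_of_forall_finset_exists'
    (fun N : ModuleCat.{u} A ↦ P N ∧ Module.IsIndecomposable A N)
    (fun X Y : ModuleCat.{u} A ↦ ¬ Nonempty (X ≃ₗ[A] Y)) fun s hs ↦ by
      obtain ⟨L, hL, hL', h⟩ := hcon s hs
      exact ⟨L, ⟨hL, hL'⟩, fun X hX ⟨e⟩ ↦ not_nonempty_iff.2 (h X hX) ⟨e.symm⟩⟩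
  let N : ULift.{u} ℕ → ModuleCat.{u} A := fun i ↦ N' i.down
  have hN : ∀ i, P (N i) := fun i ↦ (hN' i.down).1
  have hNi : ∀ i, Module.IsIndecomposable A (N i) := fun i ↦ (hN' i.down).2
  obtain ⟨D, hD, ⟨κ, F, hF, ⟨ρ⟩⟩, s, hs⟩ := hP.exists_finite_support_section hloc N hN
  have : Nontrivial ((∀ i, N i) ⧸ D) := by
    have hne : ∀ i, ∃ x : N i, x ≠ 0 := fun i ↦ @exists_ne _ (hNi i).1 0
    choose x hx using hne
    refine ⟨D.mkQ x, 0, fun h ↦ ?_⟩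
    have hfin := (hD x).1 ((Submodule.Quotient.mk_eq_zero D).1 h)
    rw [show {i | x i ≠ 0} = Set.univ from Set.eq_univ_of_forall hx] at hfin
    exact Set.infinite_univ hfin
  have := fun j ↦ hP.finite _ (hF j)
  obtain ⟨L, _, _, a, b, hLf, hL, hba⟩ :=
    Module.exists_isIndecomposable_retract_of_directSum (A := A) (fun j ↦ F j)
      (C := (∀ i, N i) ⧸ D) (ρ.i ≫ (coprodIsoDirectSum F).hom).hom
      ((coprodIsoDirectSum F).inv ≫ ρ.r).hom (by
        rw [← ModuleCat.hom_comp, Category.assoc, Iso.hom_inv_id_assoc, ρ.retract]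
        rfl)
  let r : (∀ i, N i) →ₗ[A] L := b ∘ₗ D.mkQ
  have hr : ∀ x ∈ D, r x = 0 := fun x hx ↦ by
    have : D.mkQ x = 0 := (Submodule.Quotient.mk_eq_zero D).2 hx
    rw [LinearMap.comp_apply, this, map_zero]
  -- A split monomorphism from `L` to the product has a nonzero component that is an isomorphism.
  have key : ∀ g : ∀ i, L →ₗ[A] N i, r ∘ₗ LinearMap.pi g = LinearMap.id →
      ∃ i, Nonempty (L ≃ₗ[A] N i) ∧ g i ≠ 0 := by
    intro g hg
    obtain ⟨_, ⟨i, h, rfl⟩, ⟨u, hu⟩⟩ := hL.exists_isUnit_of_span_eq_top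
      (Ideal.span_endomorphisms_eq_top_of_split_pi R (N := fun i ↦ N i) g r hg)
    have hL' := hL.1
    have hinv : ((↑u⁻¹ : Module.End A L) ∘ₗ h) ∘ₗ g i = LinearMap.id := by
      have : (↑u⁻¹ : Module.End A L) * ↑u = 1 := Units.inv_mul u
      rw [hu] at this
      exact this
    refine ⟨i, ⟨LinearEquiv.ofBijective (g i)
      ((hNi i).bijective_of_leftInverse (g i) _ hinv)⟩, fun h0 ↦ ?_⟩
    obtain ⟨l, hl⟩ := exists_ne (0 : L)
    apply hl
    have := LinearMap.congr_fun hinv l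
    rw [LinearMap.comp_apply, h0, LinearMap.zero_apply, map_zero] at this
    exact this.symm
  let f : ∀ i, L →ₗ[A] N i := fun i ↦ LinearMap.proj i ∘ₗ s ∘ₗ a
  have hf : r ∘ₗ LinearMap.pi f = LinearMap.id := by
    rw [← hba]
    ext l
    exact congrArg b (LinearMap.congr_fun hs (a l))
  obtain ⟨i₀, ⟨e₀⟩, -⟩ := key f hf
  -- Changing one component of `f` changes its values by families of finite support.
  obtain ⟨i₁, ⟨e₁⟩, h₁⟩ := key (Function.update f i₀ 0) (by
    rw [← hf]
    ext l
    change r (LinearMap.pi (Function.update f i₀ 0) l) = r (LinearMap.pi f l)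
    rw [← sub_eq_zero, ← map_sub]
    refine hr _ ((hD _).2 ((Set.finite_singleton i₀).subset fun i hi ↦ ?_))
    by_contra h
    exact hi (by simp [Function.update_of_ne (show i ≠ i₀ from h)]))
  have hne : i₁ ≠ i₀ := by
    rintro rfl
    simp at h₁
  exact hpair (fun h ↦ hne (ULift.ext _ _ h) : i₁.down ≠ i₀.down) ⟨e₁.symm.trans e₀⟩

/-- The product of the indecomposables in `P`, one from each isomorphism class, is an additive
generator of `P`. -/
theorem exists_generator (R : Type v) [CommRing R] [IsArtinianRing R] [Algebra R A]
    [Module.Finite R A] [IsNoetherianRing A] (hP : IsFGClusterTilting n P)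
    (hloc : isLocally P ≤ ObjectProperty.addClosure.{u} P) :
    ∃ M : ModuleCat.{u} A, P M ∧ ∀ X : ModuleCat.{u} A, P X →
      ∃ (k : ℕ) (i : X →ₗ[A] (Fin k → M)) (r : (Fin k → M) →ₗ[A] X), r ∘ₗ i = LinearMap.id := by
  classical
  have : IsArtinianRing A := isArtinian_of_tower R inferInstance
  obtain ⟨s, hs, hs'⟩ := hP.exists_finset_indecomposable R hloc
  let N : Fin s.card → ModuleCat.{u} A := fun t ↦ s.equivFin.symm t
  let M : ModuleCat.{u} A := ModuleCat.of A (∀ t, N t)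
  refine ⟨M, hP.pi N fun t ↦ (hs _ (s.equivFin.symm t).2).1, fun X hX ↦ ?_⟩
  have hXf := hP.finite X hX
  refine Module.induction_on_indecomposable (A := A) (P := fun X _ _ ↦ P (ModuleCat.of A X) →
    ∃ (k : ℕ) (i : X →ₗ[A] (Fin k → M)) (r : (Fin k → M) →ₗ[A] X), r ∘ₗ i = LinearMap.id)
    (fun X _ _ h _ ↦ ⟨0, 0, 0, LinearMap.ext fun x ↦ Subsingleton.elim _ _⟩)
    (fun L _ _ _ hL hPL ↦ ?_) (fun X _ _ p q hpq hp hq hPX ↦ ?_) X hX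
  · obtain ⟨N₀, hN₀, ⟨e⟩⟩ := hs' (ModuleCat.of A L) hPL hL
    obtain ⟨t, ht⟩ : ∃ t, N t = N₀ := ⟨s.equivFin ⟨N₀, hN₀⟩, by simp [N]⟩
    subst ht
    refine ⟨1, LinearMap.pi fun _ ↦ LinearMap.single A (fun t ↦ N t) t ∘ₗ e.toLinearMap,
      e.symm.toLinearMap ∘ₗ LinearMap.proj t ∘ₗ LinearMap.proj 0, LinearMap.ext fun l ↦ ?_⟩
    exact (congrArg e.symm (Pi.single_eq_same (M := fun t ↦ (N t : Type u)) t (e l))).trans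
      (e.symm_apply_apply l)
  · have hsum : ∀ x, (p.projectionOnto q hpq x : X) + q.projectionOnto p hpq.symm x = x := by
      intro x
      obtain ⟨a, ha, b, hb, rfl⟩ := Submodule.mem_sup.1
        (hpq.sup_eq_top ▸ Submodule.mem_top : x ∈ p ⊔ q)
      rw [map_add, map_add, Submodule.projectionOnto_apply_of_mem_left hpq ha,
        Submodule.projectionOnto_apply_of_mem_left hpq.symm hb,
        (Submodule.projectionOnto_apply_eq_zero_iff hpq).2 hb,
        (Submodule.projectionOnto_apply_eq_zero_iff hpq.symm).2 ha, add_zero, zero_add]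
    obtain ⟨k, i, r, hri⟩ := hp (hP.of_linearRetract p.subtype (p.projectionOnto q hpq)
      (LinearMap.ext fun x ↦ Submodule.projectionOnto_apply_left hpq x) hPX)
    obtain ⟨l, i', r', hri'⟩ := hq (hP.of_linearRetract q.subtype (q.projectionOnto p hpq.symm)
      (LinearMap.ext fun x ↦ Submodule.projectionOnto_apply_left hpq.symm x) hPX)
    refine ⟨k + l,
      LinearMap.pi (Fin.append (fun s ↦ LinearMap.proj s ∘ₗ i ∘ₗ p.projectionOnto q hpq)
        fun s ↦ LinearMap.proj s ∘ₗ i' ∘ₗ q.projectionOnto p hpq.symm),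
      p.subtype ∘ₗ r ∘ₗ LinearMap.funLeft A M (Fin.castAdd l) +
        q.subtype ∘ₗ r' ∘ₗ LinearMap.funLeft A M (Fin.natAdd k), LinearMap.ext fun x ↦ ?_⟩
    have h₁ : (LinearMap.funLeft A M (Fin.castAdd l)) (LinearMap.pi (Fin.append
        (fun s ↦ LinearMap.proj s ∘ₗ i ∘ₗ p.projectionOnto q hpq)
        fun s ↦ LinearMap.proj s ∘ₗ i' ∘ₗ q.projectionOnto p hpq.symm) x) =
        i (p.projectionOnto q hpq x) := by
      ext1 s
      simp [LinearMap.funLeft_apply]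
    have h₂ : (LinearMap.funLeft A M (Fin.natAdd k)) (LinearMap.pi (Fin.append
        (fun s ↦ LinearMap.proj s ∘ₗ i ∘ₗ p.projectionOnto q hpq)
        fun s ↦ LinearMap.proj s ∘ₗ i' ∘ₗ q.projectionOnto p hpq.symm) x) =
        i' (q.projectionOnto p hpq.symm x) := by
      ext1 s
      simp [LinearMap.funLeft_apply]
    rw [LinearMap.comp_apply, LinearMap.add_apply, LinearMap.comp_apply, LinearMap.comp_apply,
      LinearMap.comp_apply, LinearMap.comp_apply, h₁, h₂, ← LinearMap.comp_apply r,
      ← LinearMap.comp_apply r', hri, hri']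
    exact hsum x

/-! ### From an additive generator to the cluster tilting property -/

/-- If every module in `P` is a summand of a finite power of `M`, then every module locally in `P`
is a direct sum of summands of `M`. -/
theorem isLocally_le_addClosure (R : Type v) [CommRing R] [IsArtinianRing R] [Algebra R A]
    [Module.Finite R A] [IsNoetherianRing A] (hP : IsFGClusterTilting n P) (M : ModuleCat.{u} A)
    (hM : P M) (hgen : ∀ X : ModuleCat.{u} A, P X → ∃ (k : ℕ) (i : X →ₗ[A] (Fin k → M))
      (r : (Fin k → M) →ₗ[A] X), r ∘ₗ i = LinearMap.id) :
    isLocally P ≤ ObjectProperty.addClosure.{u} P := by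
  intro X hX
  have : IsArtinianRing A := isArtinian_of_tower R inferInstance
  have := hP.finite M hM
  have hX' : Module.IsLocallyAdd (A := A) M X := by
    intro B _ _ _ f
    obtain ⟨N, g, h, hN, hgh⟩ := hX (ModuleCat.of A B) ‹_› (ModuleCat.ofHom f)
    obtain ⟨k, i, r, hri⟩ := hgen N hN
    refine ⟨k, i ∘ₗ g.hom, h.hom ∘ₗ r, LinearMap.ext fun b ↦ ?_⟩
    have h1 := LinearMap.congr_fun hri (g.hom b)
    have h2 := LinearMap.congr_fun (congrArg ModuleCat.Hom.hom hgh) b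
    exact (congrArg h.hom h1).trans h2
  obtain ⟨S, hS, hind, htop⟩ := hX'.exists_isInternal (Module.isNilpotent_jacobson_end R M)
  classical
  let e : (DirectSum S fun L ↦ (L : Submodule A X)) ≃ₗ[A] X :=
    LinearEquiv.ofBijective (DirectSum.coeLinearMap fun L : S ↦ (L : Submodule A X))
      (DirectSum.isInternal_submodule_of_iSupIndep_of_iSup_eq_top hind htop)
  refine ⟨S, fun L ↦ ModuleCat.of A (L : Submodule A X), fun L ↦ ?_,
    ⟨Retract.ofIso (e.symm.toModuleIso ≪≫ (coprodIsoDirectSum fun L : S ↦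
      ModuleCat.of A (L : Submodule A X)).symm)⟩⟩
  obtain ⟨i, r, hri⟩ := hS L L.2
  exact hP.of_linearRetract i r hri hM

/-- The direct sum of a family in `P` is a direct summand of its product. -/
theorem exists_retract_sigma_pi [IsNoetherianRing A] (hP : IsFGClusterTilting n P)
    (hloc : isLocally P ≤ ObjectProperty.addClosure.{u} P)
    {ι : Type u} (N : ι → ModuleCat.{u} A) (hN : ∀ i, P (N i)) :
    Nonempty (Retract (∐ N) (ModuleCat.of A (∀ i, N i))) := by
  classical
  obtain ⟨D, hD, -, s, hs⟩ := hP.exists_finite_support_section hloc N hN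
  let c : DirectSum ι (fun i ↦ N i) →ₗ[A] (∀ i, N i) := DFinsupp.coeFnLinearMap A
  have hc : Function.Injective c := DFunLike.coe_injective
  let e := LinearEquiv.ofInjective c hc
  have hcD : ∀ x, x ∈ D ↔ x ∈ LinearMap.range c := by
    intro x
    rw [hD]
    constructor
    · intro hx
      refine ⟨DFinsupp.mk (β := fun i ↦ (N i : Type u)) hx.toFinset fun i ↦ x i, funext fun i ↦ ?_⟩
      change DFinsupp.mk (β := fun i ↦ (N i : Type u)) hx.toFinset (fun i ↦ x i) i = x i
      rw [DFinsupp.mk_apply]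
      split_ifs with h
      · rfl
      · by_contra h0
        exact h (hx.mem_toFinset.2 (Ne.symm h0))
    · rintro ⟨y, rfl⟩
      exact (DFinsupp.support y).finite_toSet.subset fun i hi ↦
        Finset.mem_coe.2 (DFinsupp.mem_support_iff.2 hi)
  have hmem : ∀ x, (LinearMap.id - s ∘ₗ D.mkQ : (∀ i, N i) →ₗ[A] (∀ i, N i)) x ∈
      LinearMap.range c := by
    intro x
    rw [← hcD, ← Submodule.Quotient.mk_eq_zero D]
    have := LinearMap.congr_fun hs (D.mkQ x)
    simp only [LinearMap.comp_apply, Submodule.mkQ_apply, LinearMap.id_apply] at this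
    simp [this]
  let ρ : (∀ i, N i) →ₗ[A] DirectSum ι (fun i ↦ N i) :=
    e.symm.toLinearMap ∘ₗ (LinearMap.id - s ∘ₗ D.mkQ).codRestrict (LinearMap.range c) hmem
  have hρ : ρ ∘ₗ c = LinearMap.id := by
    refine LinearMap.ext fun x ↦ ?_
    have h0 : D.mkQ (c x) = 0 := (Submodule.Quotient.mk_eq_zero D).2 ((hcD _).2 ⟨x, rfl⟩)
    have h1 : (LinearMap.id - s ∘ₗ D.mkQ).codRestrict (LinearMap.range c) hmem (c x) = e x :=
      Subtype.ext (by simp [h0, e])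
    rw [LinearMap.comp_apply, LinearMap.comp_apply, h1]
    exact e.symm_apply_apply x
  exact ⟨(Retract.ofIso (coprodIsoDirectSum N)).trans
    { i := ModuleCat.ofHom c, r := ModuleCat.ofHom ρ, retract := ModuleCat.hom_ext hρ }⟩

theorem addClosure_le_isLocally [IsNoetherianRing A] (hP : IsFGClusterTilting n P)
    (hloc : isLocally P ≤ ObjectProperty.addClosure.{u} P) :
    ObjectProperty.addClosure.{u} P ≤ isLocally P := by
  rintro X ⟨ι, F, hF, ⟨r⟩⟩ B hB f
  obtain ⟨r'⟩ := hP.exists_retract_sigma_pi hloc F hF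
  obtain ⟨N, g, h, hN, hgh⟩ := hP.isLocally_pi F hF B hB (f ≫ (r.trans r').i)
  exact ⟨N, g, h ≫ (r.trans r').r, hN, by
    rw [← Category.assoc, hgh, Category.assoc, (r.trans r').retract, Category.comp_id]⟩

/-- For a class `P` of finitely generated modules in which every module is a summand of a power of
`M`, the cluster tilting property of `Add P` follows from the equality of `Add P` with the class of
modules locally in `P`. -/
theorem isClusterTilting_addClosure [IsNoetherianRing A] (hP : IsFGClusterTilting n P)
    (hloc : isLocally P ≤ ObjectProperty.addClosure.{u} P) (M : ModuleCat.{u} A) (hM : P M)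
    (hgen : ∀ X : ModuleCat.{u} A, P X → ∃ (k : ℕ) (i : X →ₗ[A] (Fin k → M))
      (r : (Fin k → M) →ₗ[A] X), r ∘ₗ i = LinearMap.id) :
    (ObjectProperty.addClosure.{u} P).IsClusterTilting n := by
  have hpow (k : ℕ) : P (ModuleCat.of A (Fin k → M)) := hP.pi (fun _ ↦ M) fun _ ↦ hM
  have gen : (ObjectProperty.addClosure.{u} P).IsGenerating := by
    intro X
    let F : X → ModuleCat.{u} A := fun _ ↦ ModuleCat.of A A
    have : Projective (ModuleCat.of A A) := (IsProjective.iff_projective (R := A) A).1 inferInstance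
    refine ⟨∐ F, Limits.Sigma.desc fun x ↦ ModuleCat.ofHom (LinearMap.toSpanSingleton A X x),
      ⟨X, F, fun _ ↦ hP.of_projective (ModuleCat.of A A), ⟨Retract.refl _⟩⟩, ?_⟩
    refine (ModuleCat.epi_iff_surjective _).2 fun x ↦ ⟨(Limits.Sigma.ι F x).hom (1 : A), ?_⟩
    have := Limits.Sigma.ι_desc
      (fun x : X ↦ (ModuleCat.ofHom (LinearMap.toSpanSingleton A X x) : F x ⟶ X)) x
    exact (LinearMap.congr_fun (congrArg ModuleCat.Hom.hom this) (1 : A)).trans (one_smul A x)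
  have contra : (ObjectProperty.addClosure.{u} P).IsContravariantlyFinite := by
    intro X
    -- the direct sum indexed by all maps from powers of `M` to `X`
    let F : ((k : ℕ) × (ModuleCat.of A (Fin k → M) ⟶ X)) → ModuleCat.{u} A :=
      fun p ↦ ModuleCat.of A (Fin p.1 → M)
    refine ⟨∐ F, Limits.Sigma.desc fun p ↦ p.2, ⟨_, F, fun p ↦ hpow p.1, ⟨Retract.refl _⟩⟩, ?_⟩
    rintro N ⟨ι, G, hG, ⟨ρ⟩⟩ g
    choose k i r hri using fun j ↦ hgen (G j) (hG j)
    refine ⟨ρ.i ≫ Limits.Sigma.desc fun j ↦ ModuleCat.ofHom (i j) ≫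
      Limits.Sigma.ι F ⟨k j, ModuleCat.ofHom (r j) ≫ Limits.Sigma.ι G j ≫ ρ.r ≫ g⟩, ?_⟩
    have hri' : ∀ j, ModuleCat.ofHom (i j) ≫ ModuleCat.ofHom (r j) = 𝟙 _ := fun j ↦
      ModuleCat.hom_ext (hri j)
    have : (Limits.Sigma.desc fun j ↦ ModuleCat.ofHom (i j) ≫
        Limits.Sigma.ι F ⟨k j, ModuleCat.ofHom (r j) ≫ Limits.Sigma.ι G j ≫ ρ.r ≫ g⟩) ≫
        Limits.Sigma.desc (fun p ↦ p.2) = ρ.r ≫ g := by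
      ext1 j
      rw [colimit.ι_desc_assoc]
      simp only [Cofan.mk_pt, Cofan.mk_ι_app, Category.assoc, colimit.ι_desc]
      rw [reassoc_of% (hri' j)]
    rw [Category.assoc, this, ρ.retract_assoc]
  have rigid (i : ℕ) (h₁ : 1 ≤ i) (h₂ : i < n) (X Y : ModuleCat.{u} A)
      (hX : ObjectProperty.addClosure.{u} P X) (hY : ObjectProperty.addClosure.{u} P Y) :
      Subsingleton (Ext.{u} X Y i) :=
    ext_addClosure_subsingleton h₁
      (hP.isLocally_iff_ext.1 (hP.addClosure_le_isLocally hloc Y hY) i h₁ h₂) hX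
  have right (X : ModuleCat.{u} A) (hX : ∀ i : ℕ, 1 ≤ i → i < n →
      ∀ N, ObjectProperty.addClosure.{u} P N → Subsingleton (Ext.{u} N X i)) :
      ObjectProperty.addClosure.{u} P X :=
    hloc X (hP.isLocally_of_ext fun i h₁ h₂ N hN ↦ hX i h₁ h₂ N (le_addClosure P N hN))
  -- Injective modules are locally in `P`, which gives cogeneration. A left approximation of `X` is
  -- the canonical map to the product indexed by all maps from `X` to powers of `M`.
  refine ⟨gen, fun X ↦ ?_, contra, fun X ↦ ?_, fun X ↦ ⟨fun hX i h₁ h₂ N hN ↦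
    rigid i h₁ h₂ X N hX hN, ObjectProperty.of_ext_left_of_generating gen contra rigid right⟩,
    fun X ↦ ⟨fun hX i h₁ h₂ N hN ↦ rigid i h₁ h₂ N X hN hX, right X⟩⟩
  · refine ⟨Injective.under X, Injective.ι X, right _ fun i h₁ h₂ N hN ↦ ?_, inferInstance⟩
    obtain ⟨i, rfl⟩ := Nat.exists_eq_add_of_le' h₁
    exact Ext.subsingleton_of_injective N _ i
  · let F : ((k : ℕ) × (X ⟶ ModuleCat.of A (Fin k → M))) → ModuleCat.{u} A :=
      fun p ↦ ModuleCat.of A (Fin p.1 → M)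
    refine ⟨ModuleCat.of A (∀ p, F p), ModuleCat.ofHom (LinearMap.pi fun p ↦ p.2.hom),
      hloc _ (hP.isLocally_pi F fun p ↦ hpow p.1), ?_⟩
    rintro N ⟨ι, G, hG, ⟨ρ⟩⟩ g
    obtain ⟨ρ'⟩ := hP.exists_retract_sigma_pi hloc G hG
    choose k i r hri using fun j ↦ hgen (G j) (hG j)
    let g' : X ⟶ ModuleCat.of A (∀ j, G j) := g ≫ ρ.i ≫ ρ'.i
    let t (j : ι) : X ⟶ ModuleCat.of A (Fin (k j) → M) :=
      ModuleCat.ofHom (i j ∘ₗ LinearMap.proj j ∘ₗ g'.hom)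
    let φ : (∀ p, F p) →ₗ[A] (∀ j, G j) :=
      LinearMap.pi fun j ↦ r j ∘ₗ LinearMap.proj (φ := fun p ↦ F p) ⟨k j, t j⟩
    have hφ : ModuleCat.ofHom (LinearMap.pi fun p ↦ p.2.hom) ≫
        (ModuleCat.ofHom φ : ModuleCat.of A (∀ p, F p) ⟶ ModuleCat.of A (∀ j, G j)) = g' := by
      refine ModuleCat.hom_ext (LinearMap.ext fun x ↦ funext fun j ↦ ?_)
      exact LinearMap.congr_fun (hri j) (g'.hom x j)
    refine ⟨ModuleCat.ofHom φ ≫ ρ'.r ≫ ρ.r, ?_⟩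
    rw [reassoc_of% hφ]
    simp [g']

end ModuleCat.IsFGClusterTilting

/-! ### Finitely generated modules as a full subcategory -/

namespace FGModuleCat

variable {A : Type u} [Ring A]

/-- In `mod-Λ` a power of a module is computed as the module of functions. -/
theorem nonempty_biproduct_iso_pi [IsNoetherianRing A] (M : FGModuleCat.{u} A) (k : ℕ) :
    Nonempty ((⨁ fun _ : Fin k ↦ M) ≅ FGModuleCat.of A (Fin k → M)) := by
  let p (s : Fin k) : FGModuleCat.of A (Fin k → M) ⟶ M :=
    ObjectProperty.homMk (ModuleCat.ofHom (LinearMap.proj s))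
  let h : (⨁ fun _ : Fin k ↦ M) ⟶ FGModuleCat.of A (Fin k → M) :=
    ObjectProperty.homMk (ModuleCat.ofHom (LinearMap.pi fun s ↦
      (biproduct.π (fun _ : Fin k ↦ M) s).hom.hom))
  have hp (s : Fin k) : h ≫ p s = biproduct.π (fun _ : Fin k ↦ M) s := rfl
  refine ⟨⟨h, biproduct.lift p, ?_, ?_⟩⟩
  · refine biproduct.hom_ext _ _ fun s ↦ ?_
    rw [Category.assoc, biproduct.lift_π, hp, Category.id_comp]
  · refine hom_ext (LinearMap.ext fun x ↦ funext fun s ↦ ?_)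
    have : (biproduct.lift p ≫ h) ≫ p s = p s := by
      rw [Category.assoc, hp, biproduct.lift_π]
    exact LinearMap.congr_fun (congrArg (fun f ↦ f.hom.hom) this) x

theorem exists_epi_of_free (X : FGModuleCat.{u} A) :
    ∃ (k : ℕ) (f : FGModuleCat.of A (Fin k → A) ⟶ X), Epi f := by
  obtain ⟨k, f, hf⟩ := Module.Finite.exists_fin' A X
  refine ⟨k, ObjectProperty.homMk (ModuleCat.ofHom f),
    (ModuleCat.isFG.{u} A).ι.epi_of_epi_map ?_⟩
  exact (ModuleCat.epi_iff_surjective _).2 hf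

variable [IsNoetherianRing A]

instance : PreservesFiniteLimits (ModuleCat.isFG.{u} A).ι :=
  inferInstanceAs (PreservesFiniteLimits (forget₂ (FGModuleCat.{u} A) (ModuleCat.{u} A)))

instance : PreservesFiniteColimits (ModuleCat.isFG.{u} A).ι :=
  inferInstanceAs (PreservesFiniteColimits (forget₂ (FGModuleCat.{u} A) (ModuleCat.{u} A)))

theorem projective_of_free (k : ℕ) : Projective (FGModuleCat.of A (Fin k → A)) where
  factors {E X} f e he := by
    have : Epi ((ModuleCat.isFG.{u} A).ι.map e) := inferInstance
    have hs : Function.Surjective e.hom.hom := (ModuleCat.epi_iff_surjective _).1 this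
    obtain ⟨g, hg⟩ := Module.projective_lifting_property e.hom.hom f.hom.hom hs
    exact ⟨ObjectProperty.homMk (ModuleCat.ofHom g), hom_ext hg⟩

instance : EnoughProjectives (FGModuleCat.{u} A) where
  presentation X := by
    obtain ⟨k, f, hf⟩ := exists_epi_of_free X
    exact ⟨{ p := _, projective := projective_of_free k, f := f, epi := hf }⟩

instance : (ModuleCat.isFG.{u} A).ι.PreservesProjectiveObjects where
  projective_obj {X} hX := by
    obtain ⟨k, f, hf⟩ := exists_epi_of_free X
    have : Projective ((ModuleCat.isFG.{u} A).ι.obj (FGModuleCat.of A (Fin k → A))) :=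
      (IsProjective.iff_projective (R := A) (Fin k → A)).1 inferInstance
    exact (Retract.map { i := Projective.factorThru (𝟙 X) f, r := f, retract := by simp }
      (ModuleCat.isFG.{u} A).ι).projective

/-- The groups `Ext` of finitely generated modules may be computed in `mod-Λ` or in `Mod-Λ`, as
both are computed by resolutions by finitely generated projectives. -/
theorem subsingleton_ext_iff (X Y : FGModuleCat.{u} A) (i : ℕ) :
    Subsingleton (Ext.{u + 1} X Y i) ↔ Subsingleton (Ext.{u} X.obj Y.obj i) :=
  (Equiv.ofBijective _ ((ModuleCat.isFG.{u} A).ι.mapExt_bijective_of_preservesProjectiveObjects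
    X Y i)).subsingleton_congr

variable {n : ℕ} {m : ObjectProperty (FGModuleCat.{u} A)}

/-- An `n`-cluster tilting subcategory of `mod-Λ`, closed under isomorphism in `Mod-Λ`. -/
theorem isFGClusterTilting_map (hm : m.IsClusterTilting n) :
    ModuleCat.IsFGClusterTilting n (m.map (ModuleCat.isFG.{u} A).ι) where
  finite := by
    rintro X ⟨Y, -, ⟨e⟩⟩
    have : Module.Finite A ((ModuleCat.isFG.{u} A).ι.obj Y) := Y.property
    exact Module.Finite.equiv e.toLinearEquiv
  rigid := by
    rintro i h₁ h₂ M N ⟨X, hX, ⟨e⟩⟩ ⟨Y, hY, ⟨e'⟩⟩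
    have := (subsingleton_ext_iff X Y i).1 ((hm.iff_ext_left X).1 hX i h₁ h₂ Y hY)
    have := Ext.subsingleton_of_retract_left (Retract.ofIso e.symm) this
    exact Ext.subsingleton_of_retract_right (Retract.ofIso e'.symm) this
  of_ext_left X hX h :=
    ⟨⟨X, hX⟩, (hm.iff_ext_left _).2 fun i h₁ h₂ M hM ↦ (subsingleton_ext_iff _ M i).2
      (h i h₁ h₂ M.obj (m.prop_map_obj _ hM)), ⟨Iso.refl _⟩⟩
  of_ext_right X hX h :=
    ⟨⟨X, hX⟩, (hm.iff_ext_right _).2 fun i h₁ h₂ M hM ↦ (subsingleton_ext_iff M _ i).2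
      (h i h₁ h₂ M.obj (m.prop_map_obj _ hM)), ⟨Iso.refl _⟩⟩
  exists_approx X hX := by
    obtain ⟨N, f, hN, hf⟩ := hm.covariantlyFinite ⟨X, hX⟩
    obtain ⟨N₁, g, hN₁, hg⟩ := hm.cogenerating ⟨X, hX⟩
    -- The approximation is a monomorphism, since a monomorphism to an object of `m` factors
    -- through it.
    obtain ⟨h, rfl⟩ := hf N₁ hN₁ g
    have := mono_of_mono f h
    refine ⟨N.obj, f.hom, m.prop_map_obj _ hN,
      inferInstanceAs (Mono ((ModuleCat.isFG.{u} A).ι.map f)), ?_⟩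
    rintro N' ⟨Y, hY, ⟨e⟩⟩ g
    obtain ⟨h, hh⟩ := hf Y hY (ObjectProperty.homMk (g ≫ e.inv))
    refine ⟨h.hom ≫ e.hom, ?_⟩
    rw [← Category.assoc, ← ObjectProperty.FullSubcategory.comp_hom, hh]
    simp

theorem prop_of_map (hm : m.IsClusterTilting n) {X : FGModuleCat.{u} A}
    (h : m.map (ModuleCat.isFG.{u} A).ι X.obj) : m X :=
  (hm.iff_ext_left X).2 fun i h₁ h₂ M hM ↦ (subsingleton_ext_iff X M i).2
    ((isFGClusterTilting_map hm).rigid i h₁ h₂ X.obj M.obj h (m.prop_map_obj _ hM))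

theorem finiteAddClosure_singleton_iff (M X : FGModuleCat.{u} A) :
    ObjectProperty.finiteAddClosure (ObjectProperty.singleton M) X ↔
      ∃ (k : ℕ) (i : X →ₗ[A] (Fin k → M)) (r : (Fin k → M) →ₗ[A] X), r ∘ₗ i = LinearMap.id := by
  constructor
  · rintro ⟨k, F, hF, ⟨ρ⟩⟩
    obtain rfl : F = fun _ ↦ M := funext fun s ↦ ((ObjectProperty.singleton_iff _ _).1 (hF s)).symm
    obtain ⟨e⟩ := nonempty_biproduct_iso_pi M k
    let ρ' := ρ.trans (Retract.ofIso e)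
    exact ⟨k, ρ'.i.hom.hom, ρ'.r.hom.hom, congrArg (fun f ↦ f.hom.hom) ρ'.retract⟩
  · rintro ⟨k, i, r, h⟩
    obtain ⟨e⟩ := nonempty_biproduct_iso_pi M k
    let ρ : Retract X (FGModuleCat.of A (Fin k → M)) :=
      { i := ObjectProperty.homMk (ModuleCat.ofHom i)
        r := ObjectProperty.homMk (ModuleCat.ofHom r)
        retract := hom_ext h }
    exact ⟨k, fun _ ↦ M, fun _ ↦ (ObjectProperty.singleton_iff _ _).2 rfl,
      ⟨ρ.trans (Retract.ofIso e.symm)⟩⟩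

end FGModuleCat

/-! ### The additive generator and the big cluster tilting subcategory -/

theorem mainTheorem1 (R : Type v) (A : Type u) [CommRing R] [IsArtinianRing R] [Ring A]
    [Algebra R A] [Module.Finite R A] (n : ℕ) (hn : 0 < n)
    (m : ObjectProperty (FGModuleCat.{u} A)) :
    haveI : IsNoetherianRing A := isNoetherianRing_of_artinAlgebra R A
    m.IsClusterTilting n →
      ((ObjectProperty.addClosure.{u} (m.map (ModuleCat.isFG.{u} A).ι)).IsClusterTilting n ↔
        m.HasAdditiveGenerator) := by
  have : IsNoetherianRing A := isNoetherianRing_of_artinAlgebra R A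
  intro hm
  have hP := FGModuleCat.isFGClusterTilting_map hm
  constructor
  · intro hbig
    have hloc : ModuleCat.isLocally (m.map (ModuleCat.isFG.{u} A).ι) ≤
        ObjectProperty.addClosure.{u} (m.map (ModuleCat.isFG.{u} A).ι) := fun X hX ↦
      (hbig.iff_ext_right X).2 fun i h₁ h₂ N hN ↦
        ModuleCat.ext_addClosure_subsingleton h₁ (hP.isLocally_iff_ext.1 hX i h₁ h₂) hN
    obtain ⟨M, hM, hgen⟩ := hP.exists_generator R hloc
    have := hP.finite M hM
    refine ⟨FGModuleCat.of A M, funext fun X ↦ propext ?_⟩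
    rw [FGModuleCat.finiteAddClosure_singleton_iff]
    refine ⟨fun hX ↦ hgen X.obj (m.prop_map_obj _ hX), ?_⟩
    rintro ⟨k, i, r, h⟩
    exact FGModuleCat.prop_of_map hm
      (hP.of_linearRetract i r h (hP.pi (fun _ ↦ M) fun _ ↦ hM))
  · rintro ⟨M, hmM⟩
    have hM : m M := by
      rw [hmM, FGModuleCat.finiteAddClosure_singleton_iff]
      exact ⟨1, LinearMap.pi fun _ ↦ LinearMap.id, LinearMap.proj 0, rfl⟩
    have hM' := m.prop_map_obj (ModuleCat.isFG.{u} A).ι hM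
    have hgen : ∀ X : ModuleCat.{u} A, m.map (ModuleCat.isFG.{u} A).ι X →
        ∃ (k : ℕ) (i : X →ₗ[A] (Fin k → M)) (r : (Fin k → M) →ₗ[A] X),
          r ∘ₗ i = LinearMap.id := by
      rintro X ⟨Y, hY, ⟨e⟩⟩
      rw [hmM, FGModuleCat.finiteAddClosure_singleton_iff] at hY
      obtain ⟨k, i, r, h⟩ := hY
      let e' : Y →ₗ[A] X := e.hom.hom
      let e'' : X →ₗ[A] Y := e.inv.hom
      refine ⟨k, i ∘ₗ e'', e' ∘ₗ r, ?_⟩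
      rw [LinearMap.comp_assoc, ← LinearMap.comp_assoc _ i, h, LinearMap.id_comp]
      exact congrArg ModuleCat.Hom.hom e.inv_hom_id
    exact hP.isClusterTilting_addClosure (hP.isLocally_le_addClosure R M.obj hM' hgen) M.obj hM'
      hgen
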